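/- Let $\mathbb{T}=\mathbb{R}/\mathbb{Z}$ and let $\mathrm{Diff}^k(\mathbb{T})$, $k\ge 1$, be the set of orientation-preserving $C^k$-diffeomorphisms of $\mathbb{T}$ (so $\phi'>0$); $\mathrm{Diff}^1(\mathbb{T})$ carries the $C^1$ topology (uniform convergence of $\phi$ and $\phi'$) and its Borel $\sigma$-algebra. For $\psi\in\mathrm{Diff}^3(\mathbb{T})$ let $\mathcal{S}_\psi=\left(\frac{\psi''}{\psi'}\right)'-\frac12\left(\frac{\psi''}{\psi'}\right)^2$ be its Schwarzian derivative. Fix $\sigma>0$ and $\alpha\in\mathbb{R}_{\ge0}\cup i\mathbb{R}_{\ge0}$, so that $\alpha^2$ is an arbitrary real number. An *unquotiented Virasoro $\alpha$-orbital measure* is a (nonnegative) Radon measure $\mu$ on $\mathrm{Diff}^1(\mathbb{T})$ such that for every $\psi\in\mathrm{Diff}^3(\mathbb{T})$ the pullback $\psi^*\mu(A)=\mu(\{\psi\circ\phi:\phi\in A\})$ is absolutely continuous with respect to $\mu$ with density $$\frac{\mathrm{d}\psi^*\mu}{\mathrm{d}\mu}(\phi)=\exp\left\{\frac{1}{\sigma^2}\int_{\mathbb{T}}\Big[\mathcal{S}_\psi(\phi(\tau))+2\alpha^2\big(\psi'(\phi(\tau))^2-1\big)\Big]\phi'(\tau)^2\,\mathrm{d}\tau\right\}.$$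 It is called *regular* if there is a real number $\beta^2$ (of either sign) such that $$\int_{\mathrm{Diff}^1(\mathbb{T})}\exp\left\{\frac{2(\beta^2-\alpha^2)}{\sigma^2}\int_{\mathbb{T}}\phi'(\tau)^2\,\mathrm{d}\tau\right\}\mathrm{d}\mu(\phi)<\infty.$$ **Theorem.** A regular unquotiented Virasoro $\alpha$-orbital measure is unique up to a multiplicative constant: if $\mu$ and $\nu$ are regular unquotiented Virasoro $\alpha$-orbital measures (for the same $\sigma$ and $\alpha$) and $\mu\neq0$, then $\nu=c\,\mu$ for some constant $c\in[0,\infty)$. As a consequence, every regular unquotiented Virasoro $\alpha$-orbital measure $\mu$ is translation-invariant: for every $\tau_0\in\mathbb{T}$ it is preserved by the map $\phi(\cdot)\mapsto\phi(\cdot+\tau_0)$. -/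

import Mathlib

open MeasureTheory
open scoped NNReal ENNReal

noncomputable section

/-- `F` is a `C^k` lift to `ℝ` of the self-map `φ` of the circle `𝕋 = ℝ/ℤ`, of degree one and with
positive derivative. -/
structure IsCircleLift (k : ℕ) (φ : UnitAddCircle → UnitAddCircle) (F : ℝ → ℝ) : Prop where
  contDiff : ContDiff ℝ k F
  deriv_pos : ∀ x, 0 < deriv F x
  map_add_one : ∀ x, F (x + 1) = F x + 1
  coe_eq : ∀ x : ℝ, φ (x : UnitAddCircle) = (F x : UnitAddCircle)

/-- `Diff^k(𝕋)`, for `k ≥ 1`: the orientation-preserving `C^k`-diffeomorphisms of the circle, that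
is, the homeomorphisms that are `C^k` with positive derivative in the angular coordinate
(the inverse is then `C^k` by the inverse function theorem). -/
structure CircleDiffeo (k : ℕ) where
  toHomeomorph : UnitAddCircle ≃ₜ UnitAddCircle
  exists_lift : ∃ F : ℝ → ℝ, IsCircleLift k toHomeomorph F

/-- The Schwarzian derivative `(F''/F')' - (F''/F')²/2` of a function of a real variable. -/
def realSchwarzian (F : ℝ → ℝ) (x : ℝ) : ℝ :=
  deriv (fun y => deriv (deriv F) y / deriv F y) x - (deriv (deriv F) x / deriv F x) ^ 2 / 2

theorem IsCircleLift.periodic_deriv {k : ℕ} {φ : UnitAddCircle → UnitAddCircle} {F : ℝ → ℝ}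
    (h : IsCircleLift k φ F) : Function.Periodic (deriv F) 1 := by
  intro x
  rw [← deriv_comp_add_const, show (fun y => F (y + 1)) = fun y => F y + 1 from
    funext h.map_add_one, deriv_add_const]

theorem IsCircleLift.periodic_schwarzian {k : ℕ} {φ : UnitAddCircle → UnitAddCircle} {F : ℝ → ℝ}
    (h : IsCircleLift k φ F) : Function.Periodic (realSchwarzian F) 1 := by
  have h1 : ∀ x, deriv F (x + 1) = deriv F x := h.periodic_deriv
  have h2 : ∀ x, deriv (deriv F) (x + 1) = deriv (deriv F) x := by
    intro x
    rw [← deriv_comp_add_const, show (fun y => deriv F (y + 1)) = deriv F from funext h1]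
  intro x
  unfold realSchwarzian
  rw [← deriv_comp_add_const]
  simp only [h1, h2]

/-- Any two lifts differ by an integer constant, so that the derivative and the Schwarzian
derivative below do not depend on the lift. -/
theorem IsCircleLift.unique {k : ℕ} {φ : UnitAddCircle → UnitAddCircle} {F G : ℝ → ℝ}
    (hF : IsCircleLift k φ F) (hG : IsCircleLift k φ G) : ∃ n : ℤ, ∀ x, F x = G x + n := by
  have hex : ∀ x, ∃ n : ℤ, (n : ℝ) = F x - G x := by
    intro x
    have h : ((F x - G x : ℝ) : UnitAddCircle) = 0 := by
      rw [AddCircle.coe_sub, ← hF.coe_eq, ← hG.coe_eq, sub_self]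
    obtain ⟨n, hn⟩ := (AddCircle.coe_eq_zero_iff (1 : ℝ)).1 h
    exact ⟨n, by simpa using hn⟩
  choose n hn using hex
  have hc : Continuous fun x => (n x : ℝ) := by
    simp only [hn]
    exact hF.contDiff.continuous.sub hG.contDiff.continuous
  have hc' : Continuous n := Int.isClosedEmbedding_coe_real.isEmbedding.continuous_iff.2 hc
  refine ⟨n 0, fun x => ?_⟩
  have h0 : n x = n 0 := PreconnectedSpace.constant inferInstance hc'
  have := hn x
  rw [h0] at this
  linarith

theorem IsCircleLift.deriv_eq {k : ℕ} {φ : UnitAddCircle → UnitAddCircle} {F G : ℝ → ℝ}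
    (hF : IsCircleLift k φ F) (hG : IsCircleLift k φ G) : deriv F = deriv G := by
  obtain ⟨n, hn⟩ := hF.unique hG
  rw [show F = fun x => G x + n from funext hn]
  exact funext fun x => deriv_add_const _

theorem IsCircleLift.schwarzian_eq {k : ℕ} {φ : UnitAddCircle → UnitAddCircle} {F G : ℝ → ℝ}
    (hF : IsCircleLift k φ F) (hG : IsCircleLift k φ G) :
    realSchwarzian F = realSchwarzian G := by
  unfold realSchwarzian
  rw [hF.deriv_eq hG]

namespace CircleDiffeo

variable {k : ℕ}

instance : CoeFun (CircleDiffeo k) fun _ => UnitAddCircle → UnitAddCircle :=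
  ⟨fun φ => φ.toHomeomorph⟩

/-- A lift of `φ`. -/
def lift (φ : CircleDiffeo k) : ℝ → ℝ := φ.exists_lift.choose

theorem isCircleLift_lift (φ : CircleDiffeo k) : IsCircleLift k φ φ.lift :=
  φ.exists_lift.choose_spec

/-- The derivative `φ' : 𝕋 → ℝ`. -/
def derivative (φ : CircleDiffeo k) : UnitAddCircle → ℝ :=
  φ.isCircleLift_lift.periodic_deriv.lift

/-- The Schwarzian derivative `S_φ : 𝕋 → ℝ` (for `k ≥ 3`). -/
def schwarzian (φ : CircleDiffeo k) : UnitAddCircle → ℝ :=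
  φ.isCircleLift_lift.periodic_schwarzian.lift

theorem continuous_derivative (φ : CircleDiffeo 1) : Continuous φ.derivative := by
  have h : Continuous (deriv φ.lift) :=
    φ.isCircleLift_lift.contDiff.continuous_deriv (by norm_num)
  exact continuous_quot_lift _ h

/-- `φ ↦ (φ, φ')`. -/
def jet (φ : CircleDiffeo 1) : C(UnitAddCircle, UnitAddCircle) × C(UnitAddCircle, ℝ) :=
  (⟨φ, φ.toHomeomorph.continuous⟩, ⟨φ.derivative, φ.continuous_derivative⟩)

/-- The `C¹` topology: uniform convergence of `φ` and of `φ'`. -/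
instance : TopologicalSpace (CircleDiffeo 1) := TopologicalSpace.induced jet inferInstance

instance : MeasurableSpace (CircleDiffeo 1) := borel _

instance : BorelSpace (CircleDiffeo 1) := ⟨rfl⟩

/-- Composition `ψ ∘ φ`, for `ψ` at least as smooth as `φ`. -/
def comp {l : ℕ} (hlk : k ≤ l) (ψ : CircleDiffeo l) (φ : CircleDiffeo k) : CircleDiffeo k where
  toHomeomorph := φ.toHomeomorph.trans ψ.toHomeomorph
  exists_lift := by
    obtain ⟨F, hF⟩ := φ.exists_lift
    obtain ⟨G, hG⟩ := ψ.exists_lift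
    refine ⟨G ∘ F, (hG.contDiff.of_le (by exact_mod_cast hlk)).comp hF.contDiff, ?_, ?_, ?_⟩
    · intro x
      have h1 : DifferentiableAt ℝ F x := differentiableAt_of_deriv_ne_zero (hF.deriv_pos x).ne'
      have h2 : DifferentiableAt ℝ G (F x) :=
        differentiableAt_of_deriv_ne_zero (hG.deriv_pos (F x)).ne'
      rw [deriv_comp x h2 h1]
      exact mul_pos (hG.deriv_pos _) (hF.deriv_pos _)
    · intro x
      simp only [Function.comp_apply, hF.map_add_one, hG.map_add_one]
    · intro x
      simp only [Homeomorph.trans_apply, Function.comp_apply, hF.coe_eq, hG.coe_eq]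

/-- The rotation `τ ↦ τ + τ₀`. -/
def rotation (k : ℕ) (τ₀ : UnitAddCircle) : CircleDiffeo k where
  toHomeomorph := Homeomorph.addRight τ₀
  exists_lift := by
    obtain ⟨t, rfl⟩ := QuotientAddGroup.mk_surjective τ₀
    refine ⟨fun x => x + t, by fun_prop, ?_, ?_, ?_⟩
    · intro x
      simp
    · intro x
      ring
    · intro x
      simp

/-- The translate `φ(· + τ₀)`. -/
def translate (τ₀ : UnitAddCircle) (φ : CircleDiffeo 1) : CircleDiffeo 1 :=
  φ.comp le_rfl (rotation 1 τ₀)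

/-- Post-composition `φ ↦ ψ ∘ φ` of `Diff¹(𝕋)` with `ψ ∈ Diff³(𝕋)`. -/
def postcomp (ψ : CircleDiffeo 3) (φ : CircleDiffeo 1) : CircleDiffeo 1 :=
  ψ.comp (by norm_num) φ

/-- `∫_𝕋 φ'(τ)² dτ`. -/
def energy (φ : CircleDiffeo 1) : ℝ := ∫ τ : UnitAddCircle, φ.derivative τ ^ 2

end CircleDiffeo

/-- A Radon measure: locally finite, and inner regular for compact sets on Borel sets. -/
structure IsRadonMeasure {X : Type*} [TopologicalSpace X] [MeasurableSpace X]
    (μ : Measure X) : Prop where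
  locallyFinite : IsLocallyFiniteMeasure μ
  innerRegular : μ.InnerRegular

/-- The density
`exp (σ⁻² ∫_𝕋 [S_ψ(φ(τ)) + 2 α² (ψ'(φ(τ))² - 1)] φ'(τ)² dτ)`; the real parameter `αsq` is `α²`. -/
def orbitalDensity (σ αsq : ℝ) (ψ : CircleDiffeo 3) (φ : CircleDiffeo 1) : ℝ :=
  Real.exp (1 / σ ^ 2 * ∫ τ : UnitAddCircle,
    (ψ.schwarzian (φ τ) + 2 * αsq * (ψ.derivative (φ τ) ^ 2 - 1)) * φ.derivative τ ^ 2)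

/-- Unquotiented Virasoro `α`-orbital measures with parameter `σ²`, where `αsq = α²`: Radon measures
`μ` on `Diff¹(𝕋)` such that for all `ψ ∈ Diff³(𝕋)` the pullback `ψ^*μ(A) = μ(ψ ∘ A)` has density
`orbitalDensity σ αsq ψ` with respect to `μ`. -/
structure IsOrbitalMeasure (σ αsq : ℝ) (μ : Measure (CircleDiffeo 1)) : Prop where
  radon : IsRadonMeasure μ
  change_of_variables : ∀ (ψ : CircleDiffeo 3) (A : Set (CircleDiffeo 1)), MeasurableSet A →
    μ (ψ.postcomp '' A) = ∫⁻ φ in A, ENNReal.ofReal (orbitalDensity σ αsq ψ φ) ∂μ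

/-- The reweighted measure `exp (2 (β² - α²) σ⁻² ∫_𝕋 φ'²) dμ(φ)`, where `αsq = α²`, `βsq = β²`. -/
def reweight (σ αsq βsq : ℝ) (μ : Measure (CircleDiffeo 1)) : Measure (CircleDiffeo 1) :=
  μ.withDensity fun φ => ENNReal.ofReal (Real.exp (2 * (βsq - αsq) / σ ^ 2 * φ.energy))

/-- An orbital measure is regular if one of its reweightings has finite total mass. -/
structure IsRegularOrbitalMeasure (σ αsq : ℝ) (μ : Measure (CircleDiffeo 1)) : Prop where
  orbital : IsOrbitalMeasure σ αsq μ
  exists_finite : ∃ βsq : ℝ, reweight σ αsq βsq μ Set.univ < ∞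

end

/-!
Write `q(u) = φ'(φ⁻¹(u))` for the speed of `φ`, `E` for its energy `∫ q`, and `s = 2 / σ²`. Let `m`
be the reweighting of an orbital measure to `α = 0`, and let
`L_g(w) = ∫ g(φ⁻¹(0)) exp(-s ∫ w q) dm(φ)`; for constant `w` the exponent is `-s w E`.

If `r` is periodic of mean `β > 0` and `w = r' + r²`, then some `ψ ∈ Diff³(𝕋)` fixing `0` satisfies
`S_ψ - 2 β² ψ'² = -2 w`, and the change of variables `φ ↦ ψ ∘ φ` gives `L_g(w) = L_g(β²)`. Letting
`w` approximate `b²` plus a point mass at `0` yields, for `β > b > 0`,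
`L_g(β²) = ∫ g(φ⁻¹(0)) exp(-s (b² E + (2 b / sinh b) (cosh β - cosh b) q(0))) dm(φ)`.
Integrated against `sinh β dβ` over `(b, ∞)` the right-hand side acquires the factor `1 / q(0)`, and
averaging over the rotations of the target, which preserve `m`, turns `g(φ⁻¹(0)) / q(0)` into `∫ g`:
`∫_b^∞ sinh β L_g(β²) dβ = (sinh b / (2 s b)) (∫ g) L_1(b²)`.
For `g = 1` differentiation in `b` is a linear differential equation, and it follows that
`L_g(b²) = C (∫ g) b exp(-s b²) / sinh b` with a constant `C` independent of `g` and `b`.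

Every continuous `w ≥ b² > 0` is of the form `r' + r²`, so `C` determines `L_g(w)` for all large
`w`. Laplace transforms determine the joint law of the root `φ⁻¹(0)` and the speed, which in turn
determine `φ`; hence `C` determines the measure. A translation `φ ↦ φ(· + τ₀)` preserves the speed
and shifts the root, which does not change `∫ g`.
-/

open Filter Topology

noncomputable section

/-! ### Circle diffeomorphisms and their lifts -/

theorem IsCircleLift.hasDerivAt {k : ℕ} {φ : UnitAddCircle → UnitAddCircle} {F : ℝ → ℝ}
    (h : IsCircleLift k φ F) (x : ℝ) : HasDerivAt F (deriv F x) x :=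
  (differentiableAt_of_deriv_ne_zero (h.deriv_pos x).ne').hasDerivAt

theorem IsCircleLift.strictMono {k : ℕ} {φ : UnitAddCircle → UnitAddCircle} {F : ℝ → ℝ}
    (h : IsCircleLift k φ F) : StrictMono F :=
  strictMono_of_deriv_pos h.deriv_pos

/-- The self-map of the circle `ℝ/ℤ` with lift `F`. -/
def circleMapOfLift (F : CircleDeg1Lift) : UnitAddCircle → UnitAddCircle :=
  Function.Periodic.lift (f := fun x : ℝ => (F x : UnitAddCircle)) (c := 1) fun x => by
    simp only [F.map_add_one, AddCircle.coe_add, AddCircle.coe_period, add_zero]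

theorem circleMapOfLift_coe (F : CircleDeg1Lift) (x : ℝ) : circleMapOfLift F x = F x := rfl

theorem continuous_circleMapOfLift {F : CircleDeg1Lift} (hF : Continuous F) :
    Continuous (circleMapOfLift F) :=
  continuous_quot_lift _ ((AddCircle.continuous_mk' 1).comp hF)

theorem bijective_circleMapOfLift {F : CircleDeg1Lift} (hF : Function.Bijective F) :
    Function.Bijective (circleMapOfLift F) := by
  constructor
  · intro a b hab
    obtain ⟨x, rfl⟩ := QuotientAddGroup.mk_surjective a
    obtain ⟨y, rfl⟩ := QuotientAddGroup.mk_surjective b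
    have hxy : ((F x - F y : ℝ) : UnitAddCircle) = 0 := by
      rw [AddCircle.coe_sub, sub_eq_zero]
      exact hab
    obtain ⟨n, hn⟩ := (AddCircle.coe_eq_zero_iff (1 : ℝ)).1 hxy
    have hx : x = y + n := hF.injective <| by
      rw [F.map_add_int, ← sub_eq_iff_eq_add', ← hn, zsmul_one]
    have hn0 : ((n : ℝ) : UnitAddCircle) = 0 :=
      (AddCircle.coe_eq_zero_iff (1 : ℝ)).2 ⟨n, by simp⟩
    change (x : UnitAddCircle) = y
    rw [hx, AddCircle.coe_add, hn0, add_zero]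
  · intro b
    obtain ⟨y, rfl⟩ := QuotientAddGroup.mk_surjective b
    obtain ⟨x, rfl⟩ := hF.surjective y
    exact ⟨x, circleMapOfLift_coe F x⟩

theorem CircleDiffeo.exists_of_lift {k : ℕ} {F : ℝ → ℝ} (hF : ContDiff ℝ k F)
    (hd : ∀ x, 0 < deriv F x) (h : ∀ x, F (x + 1) = F x + 1) :
    ∃ φ : CircleDiffeo k, IsCircleLift k φ F := by
  have hm : StrictMono F := strictMono_of_deriv_pos hd
  let f : CircleDeg1Lift := ⟨⟨F, hm.monotone⟩, h⟩
  have hf : Function.Bijective f := ⟨hm.injective, f.continuous_iff_surjective.1 hF.continuous⟩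
  have hl : IsCircleLift k (circleMapOfLift f) F := ⟨hF, hd, h, circleMapOfLift_coe f⟩
  exact ⟨⟨Continuous.homeoOfEquivCompactToT2
    (f := Equiv.ofBijective _ (bijective_circleMapOfLift hf))
    (continuous_circleMapOfLift hF.continuous), F, hl⟩, hl⟩

namespace CircleDiffeo

variable {k l : ℕ}

theorem ext_fun {φ ψ : CircleDiffeo k} (h : ∀ τ, φ τ = ψ τ) : φ = ψ := by
  cases φ; cases ψ
  congr
  exact Homeomorph.ext h

theorem derivative_coe {φ : CircleDiffeo k} {F : ℝ → ℝ} (hF : IsCircleLift k φ F) (x : ℝ) :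
    φ.derivative x = deriv F x := by
  rw [hF.deriv_eq φ.isCircleLift_lift]
  rfl

theorem schwarzian_coe {φ : CircleDiffeo k} {F : ℝ → ℝ} (hF : IsCircleLift k φ F) (x : ℝ) :
    φ.schwarzian x = realSchwarzian F x := by
  rw [hF.schwarzian_eq φ.isCircleLift_lift]
  rfl

theorem derivative_pos (φ : CircleDiffeo k) (τ : UnitAddCircle) : 0 < φ.derivative τ := by
  obtain ⟨x, rfl⟩ := QuotientAddGroup.mk_surjective τ
  exact φ.isCircleLift_lift.deriv_pos x

theorem continuous_derivative_of_one_le (hk : 1 ≤ k) (φ : CircleDiffeo k) :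
    Continuous φ.derivative :=
  continuous_quot_lift _ (φ.isCircleLift_lift.contDiff.continuous_deriv (by exact_mod_cast hk))

theorem isCircleLift_comp (hkl : k ≤ l) {ψ : CircleDiffeo l} {φ : CircleDiffeo k}
    {F G : ℝ → ℝ} (hG : IsCircleLift l ψ G) (hF : IsCircleLift k φ F) :
    IsCircleLift k (ψ.comp hkl φ) (G ∘ F) where
  contDiff := (hG.contDiff.of_le (by exact_mod_cast hkl)).comp hF.contDiff
  deriv_pos x := by
    rw [((hG.hasDerivAt (F x)).comp x (hF.hasDerivAt x)).deriv]
    exact mul_pos (hG.deriv_pos _) (hF.deriv_pos _)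
  map_add_one x := by simp only [Function.comp_apply, hF.map_add_one, hG.map_add_one]
  coe_eq x := (congrArg ψ (hF.coe_eq x)).trans (hG.coe_eq (F x))

theorem derivative_comp (hkl : k ≤ l) (ψ : CircleDiffeo l) (φ : CircleDiffeo k)
    (τ : UnitAddCircle) :
    (ψ.comp hkl φ).derivative τ = ψ.derivative (φ τ) * φ.derivative τ := by
  obtain ⟨x, rfl⟩ := QuotientAddGroup.mk_surjective τ
  have hG := ψ.isCircleLift_lift
  have hF := φ.isCircleLift_lift
  change (ψ.comp hkl φ).derivative (x : UnitAddCircle)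
    = ψ.derivative (φ (x : UnitAddCircle)) * φ.derivative (x : UnitAddCircle)
  rw [derivative_coe (isCircleLift_comp hkl hG hF), derivative_coe hF, hF.coe_eq,
    derivative_coe hG, ((hG.hasDerivAt _).comp x (hF.hasDerivAt x)).deriv]

/-- The inverse diffeomorphism. -/
def symm (φ : CircleDiffeo k) : CircleDiffeo k where
  toHomeomorph := φ.toHomeomorph.symm
  exists_lift := by
    obtain ⟨F, hF⟩ := φ.exists_lift
    let f : CircleDeg1Lift := ⟨⟨F, hF.strictMono.monotone⟩, hF.map_add_one⟩
    let e : ℝ ≃ₜ ℝ := (hF.strictMono.orderIsoOfSurjective F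
      (f.continuous_iff_surjective.1 hF.contDiff.continuous)).toHomeomorph
    have hFe : ∀ y, F (e.symm y) = y := e.apply_symm_apply
    have he : ∀ y, HasDerivAt e.symm (deriv F (e.symm y))⁻¹ y := fun y =>
      HasDerivAt.of_local_left_inverse e.symm.continuous.continuousAt
        (hF.hasDerivAt (e.symm y)) (hF.deriv_pos _).ne' (Eventually.of_forall hFe)
    refine ⟨e.symm, ?_, fun y => ?_, fun y => ?_, fun y => ?_⟩
    · exact e.contDiff_symm_deriv (f' := deriv F) (fun x => (hF.deriv_pos x).ne') hF.hasDerivAt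
        hF.contDiff
    · rw [(he y).deriv]
      exact inv_pos.2 (hF.deriv_pos _)
    · apply hF.strictMono.injective
      rw [hFe, hF.map_add_one, hFe]
    · rw [Homeomorph.symm_apply_eq, hF.coe_eq, hFe]

@[simp]
theorem apply_symm_apply (φ : CircleDiffeo k) (u : UnitAddCircle) : φ (φ.symm u) = u :=
  φ.toHomeomorph.apply_symm_apply u

@[simp]
theorem symm_apply_apply (φ : CircleDiffeo k) (τ : UnitAddCircle) : φ.symm (φ τ) = τ :=
  φ.toHomeomorph.symm_apply_apply τ

theorem symm_apply_eq {φ : CircleDiffeo k} {u τ : UnitAddCircle} : φ.symm u = τ ↔ u = φ τ :=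
  φ.toHomeomorph.symm_apply_eq

theorem symm_injective : Function.Injective (symm : CircleDiffeo k → CircleDiffeo k) :=
  fun φ ψ h => ext_fun fun τ => by
    rw [← symm_apply_eq, ← h, symm_apply_apply]

theorem symm_postcomp (ψ : CircleDiffeo 3) (φ : CircleDiffeo 1) (u : UnitAddCircle) :
    (ψ.postcomp φ).symm u = φ.symm (ψ.symm u) := rfl

theorem postcomp_surjective (ψ : CircleDiffeo 3) : Function.Surjective ψ.postcomp := fun φ =>
  ⟨ψ.symm.postcomp φ, ext_fun fun τ => ψ.apply_symm_apply (φ τ)⟩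

theorem symm_translate (τ₀ : UnitAddCircle) (φ : CircleDiffeo 1) (u : UnitAddCircle) :
    (translate τ₀ φ).symm u = φ.symm u - τ₀ := by
  rw [symm_apply_eq]
  change u = φ (φ.symm u - τ₀ + τ₀)
  rw [sub_add_cancel, apply_symm_apply]

theorem isCircleLift_rotation (k : ℕ) (t : ℝ) : IsCircleLift k (rotation k t) (· + t) where
  contDiff := by fun_prop
  deriv_pos x := by simp
  map_add_one x := by ring
  coe_eq x := (AddCircle.coe_add 1 x t).symm

theorem derivative_rotation (τ₀ τ : UnitAddCircle) : (rotation k τ₀).derivative τ = 1 := by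
  obtain ⟨t, rfl⟩ := QuotientAddGroup.mk_surjective τ₀
  obtain ⟨x, rfl⟩ := QuotientAddGroup.mk_surjective τ
  exact (derivative_coe (isCircleLift_rotation k t) x).trans (by simp)

theorem schwarzian_rotation (τ₀ τ : UnitAddCircle) : (rotation k τ₀).schwarzian τ = 0 := by
  obtain ⟨t, rfl⟩ := QuotientAddGroup.mk_surjective τ₀
  obtain ⟨x, rfl⟩ := QuotientAddGroup.mk_surjective τ
  refine (schwarzian_coe (isCircleLift_rotation k t) x).trans ?_
  have : deriv (fun x : ℝ => x + t) = fun _ => 1 := by ext; simp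
  simp [realSchwarzian, this]

theorem derivative_translate (τ₀ : UnitAddCircle) (φ : CircleDiffeo 1) (τ : UnitAddCircle) :
    (translate τ₀ φ).derivative τ = φ.derivative (τ + τ₀) := by
  rw [translate, derivative_comp, derivative_rotation, mul_one]
  rfl

theorem derivative_symm (φ : CircleDiffeo k) (u : UnitAddCircle) :
    φ.symm.derivative u = (φ.derivative (φ.symm u))⁻¹ := by
  have h : φ.comp le_rfl φ.symm = rotation k 0 := ext_fun fun τ =>
    (φ.apply_symm_apply τ).trans (add_zero τ).symm
  apply eq_inv_of_mul_eq_one_right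
  rw [← derivative_comp le_rfl, h, derivative_rotation]

theorem eq_of_derivative_eq {φ ψ : CircleDiffeo k} (h : φ.derivative = ψ.derivative)
    (h0 : φ 0 = ψ 0) : φ = ψ := by
  have hF := φ.isCircleLift_lift
  have hG := ψ.isCircleLift_lift
  have hd : ∀ x, HasDerivAt (fun x => φ.lift x - ψ.lift x) 0 x := fun x => by
    convert! (hF.hasDerivAt x).fun_sub (hG.hasDerivAt x) using 1
    rw [← derivative_coe hF, ← derivative_coe hG, h, sub_self]
  have hc : ∀ x, φ.lift x - ψ.lift x = φ.lift 0 - ψ.lift 0 := fun x =>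
    is_const_of_deriv_eq_zero (fun x => (hd x).differentiableAt) (fun x => (hd x).deriv) x 0
  refine ext_fun fun τ => ?_
  obtain ⟨x, rfl⟩ := QuotientAddGroup.mk_surjective τ
  rw [← sub_eq_zero, hF.coe_eq, hG.coe_eq, ← AddCircle.coe_sub, hc, AddCircle.coe_sub,
    ← hF.coe_eq, ← hG.coe_eq, sub_eq_zero]
  exact h0

/-! ### Continuity in the `C¹` topology -/

theorem continuous_jet : Continuous jet := continuous_induced_dom

theorem continuous_eval : Continuous fun p : CircleDiffeo 1 × UnitAddCircle => p.1 p.2 :=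
  (continuous_fst.comp (continuous_jet.comp continuous_fst)).eval continuous_snd

theorem continuous_derivative_eval :
    Continuous fun p : CircleDiffeo 1 × UnitAddCircle => p.1.derivative p.2 :=
  (continuous_snd.comp (continuous_jet.comp continuous_fst)).eval continuous_snd

/-- The set of `(φ, u)` with `φ⁻¹ u` in a closed set `C` is the projection along the compact circle
of the closed set of all `(φ, u, τ)` with `φ τ = u` and `τ ∈ C`. -/
theorem continuous_symm_eval :
    Continuous fun p : CircleDiffeo 1 × UnitAddCircle => p.1.symm p.2 := by
  refine continuous_iff_isClosed.2 fun C hC => ?_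
  have hgraph : IsClosed {p : (CircleDiffeo 1 × UnitAddCircle) × UnitAddCircle |
      p.1.1 p.2 = p.1.2 ∧ p.2 ∈ C} :=
    (isClosed_eq (continuous_eval.comp ((continuous_fst.comp continuous_fst).prodMk continuous_snd))
      (continuous_snd.comp continuous_fst)).inter (hC.preimage continuous_snd)
  convert! isClosedMap_fst_of_compactSpace _ hgraph using 1
  ext p
  constructor
  · intro hp
    exact ⟨(p, p.1.symm p.2), ⟨p.1.apply_symm_apply p.2, hp⟩, rfl⟩
  · rintro ⟨⟨p, τ⟩, ⟨hpτ, hτ⟩, rfl⟩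
    change p.1.symm p.2 ∈ C
    rwa [symm_apply_eq.2 (Eq.symm hpτ)]

theorem continuous_of_continuous_eval {X : Type*} [TopologicalSpace X] {f : X → CircleDiffeo 1}
    (h : Continuous fun p : X × UnitAddCircle => f p.1 p.2)
    (h' : Continuous fun p : X × UnitAddCircle => (f p.1).derivative p.2) : Continuous f :=
  continuous_induced_rng.2 <|
    (ContinuousMap.continuous_of_continuous_uncurry (fun x => (jet (f x)).1) h).prodMk
      (ContinuousMap.continuous_of_continuous_uncurry (fun x => (jet (f x)).2) h')

theorem continuous_postcomp (ψ : CircleDiffeo 3) : Continuous ψ.postcomp := by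
  refine continuous_of_continuous_eval (ψ.toHomeomorph.continuous.comp continuous_eval) ?_
  simp only [postcomp, derivative_comp]
  exact ((continuous_derivative_of_one_le (by norm_num) ψ).comp continuous_eval).mul
    continuous_derivative_eval

theorem continuous_translate (τ₀ : UnitAddCircle) : Continuous (translate τ₀) := by
  have h : Continuous fun p : CircleDiffeo 1 × UnitAddCircle => (p.1, p.2 + τ₀) := by fun_prop
  refine continuous_of_continuous_eval (continuous_eval.comp h) ?_
  simp only [derivative_translate]
  exact continuous_derivative_eval.comp h

/-! ### The speed of a diffeomorphism as a function of its value -/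

/-- The function `u ↦ φ'(φ⁻¹(u))`. Expressed through it, the integrals over `𝕋` that occur in the
density of an orbital measure become linear: `∫ w(φ(τ)) φ'(τ)² dτ = ∫ w(u) speed φ u du`. -/
def speed (φ : CircleDiffeo 1) : C(UnitAddCircle, ℝ≥0) where
  toFun u := ⟨φ.derivative (φ.symm u), (φ.derivative_pos _).le⟩
  continuous_toFun := Continuous.subtype_mk
    (φ.continuous_derivative.comp φ.symm.toHomeomorph.continuous) _

theorem coe_speed (φ : CircleDiffeo 1) (u : UnitAddCircle) :
    (φ.speed u : ℝ) = φ.derivative (φ.symm u) := rfl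

theorem speed_pos (φ : CircleDiffeo 1) (u : UnitAddCircle) : 0 < (φ.speed u : ℝ) :=
  φ.derivative_pos _

theorem coe_speed_apply (φ : CircleDiffeo 1) (τ : UnitAddCircle) :
    (φ.speed (φ τ) : ℝ) = φ.derivative τ := by
  rw [coe_speed, symm_apply_apply]

theorem continuous_speed_eval :
    Continuous fun p : CircleDiffeo 1 × UnitAddCircle => p.1.speed p.2 :=
  Continuous.subtype_mk
    (continuous_derivative_eval.comp (continuous_fst.prodMk continuous_symm_eval)) _

theorem continuous_speed : Continuous speed :=
  ContinuousMap.continuous_of_continuous_uncurry _ continuous_speed_eval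

theorem speed_translate (τ₀ : UnitAddCircle) (φ : CircleDiffeo 1) :
    (translate τ₀ φ).speed = φ.speed := by
  ext u
  rw [coe_speed, coe_speed, derivative_translate, symm_translate, sub_add_cancel]

theorem eq_of_symm_zero_eq_of_speed_eq {φ ψ : CircleDiffeo 1} (h0 : φ.symm 0 = ψ.symm 0)
    (h : φ.speed = ψ.speed) : φ = ψ := by
  refine symm_injective (eq_of_derivative_eq (funext fun u => ?_) h0)
  rw [derivative_symm, derivative_symm, ← coe_speed, ← coe_speed, h]

theorem integral_comp_mul_derivative {E : Type*} [NormedAddCommGroup E] [NormedSpace ℝ E]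
    (hk : 1 ≤ k) (φ : CircleDiffeo k) {f : UnitAddCircle → E} (hf : Continuous f) :
    ∫ τ, φ.derivative τ • f (φ τ) = ∫ u, f u := by
  have hF := φ.isCircleLift_lift
  set F := φ.lift
  rw [← UnitAddCircle.intervalIntegral_preimage 0, ← UnitAddCircle.intervalIntegral_preimage (F 0)]
  have hlift : ∀ x : ℝ, φ.derivative (x : UnitAddCircle) • f (φ (x : UnitAddCircle))
      = deriv F x • ((fun y : ℝ => f (y : UnitAddCircle)) ∘ F) x := fun x => by
    rw [derivative_coe hF, hF.coe_eq]
    rfl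
  have hc : Continuous fun y : ℝ => f (y : UnitAddCircle) := hf.comp (AddCircle.continuous_mk' 1)
  simp only [hlift]
  rw [intervalIntegral.integral_deriv_smul_comp (fun x _ => hF.hasDerivAt x)
    (hF.contDiff.continuous_deriv (by exact_mod_cast hk)).continuousOn hc, hF.map_add_one]

theorem integral_mul_speed (φ : CircleDiffeo 1) {w : UnitAddCircle → ℝ} (hw : Continuous w) :
    ∫ u, w u * φ.speed u = ∫ τ, w (φ τ) * φ.derivative τ ^ 2 := by
  have hc : Continuous fun u => w u * (φ.speed u : ℝ) := by fun_prop
  rw [← φ.integral_comp_mul_derivative le_rfl hc]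
  refine integral_congr_ae (Eventually.of_forall fun τ => ?_)
  simp only [coe_speed_apply, smul_eq_mul]
  ring

theorem energy_eq (φ : CircleDiffeo 1) : φ.energy = ∫ u, (φ.speed u : ℝ) := by
  simpa [energy] using (φ.integral_mul_speed (w := fun _ => 1) continuous_const).symm

theorem energy_postcomp (ψ : CircleDiffeo 3) (φ : CircleDiffeo 1) :
    (ψ.postcomp φ).energy = ∫ u, ψ.derivative u ^ 2 * φ.speed u := by
  rw [φ.integral_mul_speed (w := fun u => ψ.derivative u ^ 2)
    ((continuous_derivative_of_one_le (by norm_num) ψ).pow 2)]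
  simp only [energy, postcomp, derivative_comp, mul_pow]

theorem integral_symm_div_speed (φ : CircleDiffeo 1) {g : UnitAddCircle → ℝ} (hg : Continuous g) :
    ∫ u, g (φ.symm u) / φ.speed u = ∫ τ, g τ := by
  have hc : Continuous fun u => g (φ.symm u) / (φ.speed u : ℝ) :=
    (hg.comp φ.symm.toHomeomorph.continuous).div₀
      (NNReal.continuous_coe.comp φ.speed.continuous) fun u => (φ.speed_pos u).ne'
  rw [← φ.integral_comp_mul_derivative le_rfl hc]
  refine integral_congr_ae (Eventually.of_forall fun τ => ?_)
  simp only [coe_speed_apply, symm_apply_apply, smul_eq_mul]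
  exact mul_div_cancel₀ _ (φ.derivative_pos τ).ne'

end CircleDiffeo

/-! ### Circle diffeomorphisms attached to periodic Riccati equations -/

theorem contDiff_succ_of_hasDerivAt {n : ℕ} {f f' : ℝ → ℝ} (h : ∀ x, HasDerivAt f (f' x) x)
    (hf' : ContDiff ℝ n f') : ContDiff ℝ (n + 1 : ℕ) f := by
  have hd : deriv f = f' := funext fun x => (h x).deriv
  push_cast
  rw [contDiff_succ_iff_deriv]
  exact ⟨fun x => (h x).differentiableAt, by simp, by rwa [hd]⟩

theorem hasDerivAt_integral_of_continuous {f : ℝ → ℝ} (hf : Continuous f) (a x : ℝ) :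
    HasDerivAt (fun x => ∫ y in a..x, f y) (f x) x :=
  (hf.integral_hasStrictDerivAt a x).hasDerivAt

/-- The function `J` is `x ↦ ∫_x^∞ e`, computed by summing a geometric series. -/
theorem exists_pos_hasDerivAt_neg_of_map_add_one {e : ℝ → ℝ} (he : Continuous e)
    (hpos : ∀ x, 0 < e x) {c : ℝ} (hc : c < 1) (hadd : ∀ x, e (x + 1) = c * e x) :
    ∃ J : ℝ → ℝ, (∀ x, 0 < J x) ∧ (∀ x, HasDerivAt J (-e x) x) ∧ ∀ x, J (x + 1) = c * J x := by
  have hi : ∀ a b, IntervalIntegrable e volume a b := he.intervalIntegrable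
  have hc' : 0 < 1 - c := by linarith
  let E : ℝ → ℝ := fun x => ∫ y in (0 : ℝ)..x, e y
  have hEadd : ∀ x, E (x + 1) = E 1 + c * E x := fun x => by
    have hshift : ∫ y in (1 : ℝ)..(x + 1), e y = c * E x := by
      rw [← intervalIntegral.integral_const_mul]
      simpa only [hadd, zero_add] using
        (intervalIntegral.integral_comp_add_right (a := 0) (b := x) e 1).symm
    rw [← hshift]
    exact (intervalIntegral.integral_add_adjacent_intervals (hi _ _) (hi _ _)).symm
  have hEstep : ∀ x, 0 < E (x + 1) - E x := fun x => by
    rw [intervalIntegral.integral_interval_sub_left (hi _ _) (hi _ _)]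
    exact intervalIntegral.intervalIntegral_pos_of_pos (hi _ _) hpos (by linarith)
  refine ⟨fun x => E 1 / (1 - c) - E x, fun x => ?_, fun x => ?_, fun x => ?_⟩
  · rw [sub_pos, lt_div_iff₀ hc']
    linarith [hEadd x, hEstep x]
  · exact (hasDerivAt_integral_of_continuous he 0 x).const_sub _
  · simp only [hEadd]
    field_simp
    ring

theorem exists_pos_floquet_solution {f : ℝ → ℝ} (hf : Continuous f) (hp : Function.Periodic f 1) :
    ∃ e : ℝ → ℝ, (∀ x, 0 < e x) ∧ (∀ x, HasDerivAt e (e x * f x) x) ∧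
      ∀ x, e (x + 1) = Real.exp (∫ x in (0 : ℝ)..1, f x) * e x := by
  refine ⟨fun x => Real.exp (∫ y in (0 : ℝ)..x, f y), fun x => Real.exp_pos _,
    fun x => (hasDerivAt_integral_of_continuous hf 0 x).exp, fun x => ?_⟩
  beta_reduce
  rw [hp.intervalIntegral_add_eq_add 0 x hf.intervalIntegrable, zero_add, Real.exp_add, mul_comm]

/-- The substitution `d = v⁻¹` turns the Bernoulli equation into a linear one, whose solution is
`d = e / (2 β J)` for a solution `e` of `e' = -2 r e` and `J x = ∫_x^∞ e`. -/
theorem exists_periodic_bernoulli_solution {r : ℝ → ℝ} (hr : Continuous r)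
    (hp : Function.Periodic r 1) {β : ℝ} (hβ : ∫ x in (0 : ℝ)..1, r x = β) (hβ0 : 0 < β) :
    ∃ d : ℝ → ℝ, (∀ x, 0 < d x) ∧ Function.Periodic d 1 ∧ ∫ x in (0 : ℝ)..1, d x = 1 ∧
      ∀ x, HasDerivAt d (d x * (-2 * r x + 2 * β * d x)) x := by
  obtain ⟨e, hepos, he, headd⟩ := exists_pos_floquet_solution (f := fun x => -2 * r x)
    (continuous_const.mul hr) fun x => congrArg _ (hp x)
  rw [intervalIntegral.integral_const_mul, hβ] at headd
  have hec : Continuous e := continuous_iff_continuousAt.2 fun x => (he x).continuousAt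
  obtain ⟨J, hJpos, hJ, hJadd⟩ := exists_pos_hasDerivAt_neg_of_map_add_one hec
    hepos (Real.exp_lt_one_iff.2 (by linarith)) headd
  have hJc : Continuous J := continuous_iff_continuousAt.2 fun x => (hJ x).continuousAt
  refine ⟨fun x => e x / (2 * β * J x), fun x => ?_, fun x => ?_, ?_, fun x => ?_⟩
  · have := hepos x
    have := hJpos x
    positivity
  · simp only [headd, hJadd, mul_left_comm (2 * β)]
    exact mul_div_mul_left _ _ (Real.exp_pos _).ne'
  · have hlog : ∀ x, HasDerivAt (fun x => -Real.log (J x) / (2 * β)) (e x / (2 * β * J x)) x :=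
      fun x => by
        convert! ((hJ x).log (hJpos x).ne').neg.div_const (2 * β) using 1
        ring
    rw [intervalIntegral.integral_eq_sub_of_hasDerivAt (fun x _ => hlog x)
      ((hec.div₀ (by fun_prop) fun x => by have := hJpos x; positivity).intervalIntegrable 0 1)]
    have hJ1 : J 1 = Real.exp (-2 * β) * J 0 := by simpa using hJadd 0
    rw [hJ1, Real.log_mul (Real.exp_pos _).ne' (hJpos 0).ne', Real.log_exp]
    field_simp
    ring
  · have := (hJpos x).ne'
    convert! (he x).div ((hJ x).const_mul (2 * β)) (by positivity) using 1
    field_simp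
    ring

theorem realSchwarzian_of_bernoulli {r F : ℝ → ℝ} {β : ℝ} (hr : Differentiable ℝ r)
    (hpos : ∀ x, 0 < deriv F x)
    (hF : ∀ x, HasDerivAt (deriv F) (deriv F x * (-2 * r x + 2 * β * deriv F x)) x) (x : ℝ) :
    realSchwarzian F x - 2 * β ^ 2 * deriv F x ^ 2 = -2 * (deriv r x + r x ^ 2) := by
  have hlog : (fun y => deriv (deriv F) y / deriv F y) = fun y => -2 * r y + 2 * β * deriv F y := by
    ext y
    rw [(hF y).deriv, mul_div_cancel_left₀ _ (hpos y).ne']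
  rw [realSchwarzian, hlog, congrFun hlog x,
    (((hr x).hasDerivAt.const_mul (-2)).fun_add ((hF x).const_mul (2 * β))).deriv]
  ring

/-- If `r` is periodic of mean `β > 0`, then the coadjoint orbit of the constant `-2β²` contains
`-2 (r' + r²)`. -/
theorem exists_circleDiffeo_of_riccati {r : ℝ → ℝ} (hr : ContDiff ℝ 1 r)
    (hp : Function.Periodic r 1) {β : ℝ} (hβ : ∫ x in (0 : ℝ)..1, r x = β) (hβ0 : 0 < β) :
    ∃ ψ : CircleDiffeo 3, ψ 0 = 0 ∧ ∀ x : ℝ, ψ.schwarzian x - 2 * β ^ 2 * ψ.derivative x ^ 2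
      = -2 * (deriv r x + r x ^ 2) := by
  obtain ⟨d, hpos, hper, hint, hd⟩ := exists_periodic_bernoulli_solution hr.continuous hp hβ hβ0
  have hd0 : Continuous d := continuous_iff_continuousAt.2 fun x => (hd x).continuousAt
  have hd1 : ContDiff ℝ (1 : ℕ) d := contDiff_succ_of_hasDerivAt (n := 0) hd <| by
    simp only [Nat.cast_zero, contDiff_zero]
    exact hd0.mul ((continuous_const.mul hr.continuous).add (continuous_const.mul hd0))
  have hd2 : ContDiff ℝ (2 : ℕ) d := contDiff_succ_of_hasDerivAt (n := 1) hd <|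
    hd1.mul ((contDiff_const.mul (by exact_mod_cast hr)).add (contDiff_const.mul hd1))
  let P : ℝ → ℝ := fun x => ∫ y in (0 : ℝ)..x, d y
  have hP : ∀ x, HasDerivAt P (d x) x := hasDerivAt_integral_of_continuous hd0 0
  have hPd : deriv P = d := funext fun x => (hP x).deriv
  obtain ⟨ψ, hψ⟩ := CircleDiffeo.exists_of_lift (contDiff_succ_of_hasDerivAt (n := 2) hP hd2)
    (fun x => by rw [hPd]; exact hpos x) fun x => by
      simpa [P, hint] using hper.intervalIntegral_add_eq_add 0 x hd0.intervalIntegrable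
  refine ⟨ψ, ?_, fun x => ?_⟩
  · simpa [P] using hψ.coe_eq 0
  · rw [CircleDiffeo.schwarzian_coe hψ, CircleDiffeo.derivative_coe hψ]
    exact realSchwarzian_of_bernoulli (hr.differentiable (by norm_num)) hψ.deriv_pos
      (by rwa [hPd]) x

/-! ### Quasi-invariant measures and their Laplace functionals -/

open CircleDiffeo

theorem integrable_of_continuous {X E : Type*} [TopologicalSpace X] [CompactSpace X]
    [MeasurableSpace X] [OpensMeasurableSpace X] [NormedAddCommGroup E]
    {μ : Measure X} [IsFiniteMeasureOnCompacts μ] {f : X → E}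
    (hf : Continuous f) : Integrable f μ :=
  hf.integrable_of_hasCompactSupport (HasCompactSupport.of_compactSpace f)

theorem continuous_integral_continuousMap {X : Type*} [TopologicalSpace X] [CompactSpace X]
    [MeasurableSpace X] [BorelSpace X] {μ : Measure X} [IsFiniteMeasure μ] :
    Continuous fun f : C(X, ℝ) => ∫ x, f x ∂μ :=
  (continuous_integral.comp (ContinuousMap.toLp 1 μ ℝ).continuous).congr fun f =>
    integral_congr_ae (ContinuousMap.coeFn_toLp μ f)

/-- The integral `∫ w q` over the circle, where `q` stands for the speed of a diffeomorphism. -/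
def circlePairing (w : UnitAddCircle → ℝ) (q : C(UnitAddCircle, ℝ≥0)) : ℝ := ∫ u, w u * q u

theorem continuous_circlePairing {w : UnitAddCircle → ℝ} (hw : Continuous w) :
    Continuous (circlePairing w) := by
  let e : C(ℝ≥0, ℝ) := ⟨NNReal.toReal, NNReal.continuous_coe⟩
  have h : Continuous fun q : C(UnitAddCircle, ℝ≥0) => (⟨w, hw⟩ : C(UnitAddCircle, ℝ)) * e.comp q :=
    continuous_const.mul (ContinuousMap.continuous_postcomp e)
  exact continuous_integral_continuousMap.comp h

theorem continuous_circlePairing_speed {w : UnitAddCircle → ℝ} (hw : Continuous w) :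
    Continuous fun φ : CircleDiffeo 1 => circlePairing w φ.speed :=
  (continuous_circlePairing hw).comp continuous_speed

theorem circlePairing_const_speed (c : ℝ) (φ : CircleDiffeo 1) :
    circlePairing (fun _ => c) φ.speed = c * φ.energy := by
  rw [circlePairing, integral_const_mul, energy_eq]

theorem continuous_energy : Continuous energy := by
  refine (continuous_circlePairing_speed (w := fun _ => 1) continuous_const).congr fun φ => ?_
  rw [circlePairing_const_speed, one_mul]

theorem CircleDiffeo.energy_nonneg (φ : CircleDiffeo 1) : 0 ≤ φ.energy :=
  integral_nonneg fun _ => sq_nonneg _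

theorem continuous_symm_apply (u : UnitAddCircle) :
    Continuous fun φ : CircleDiffeo 1 => φ.symm u :=
  continuous_symm_eval.comp (continuous_id.prodMk continuous_const)

theorem continuous_schwarzian (ψ : CircleDiffeo 3) : Continuous ψ.schwarzian := by
  have hF := ψ.isCircleLift_lift
  have h3 : ContDiff ℝ 3 ψ.lift := hF.contDiff
  have h2 : ContDiff ℝ 2 (deriv ψ.lift) := ((contDiff_succ_iff_deriv (n := 2)).1 h3).2.2
  have h1 : ContDiff ℝ 1 (deriv (deriv ψ.lift)) := ((contDiff_succ_iff_deriv (n := 1)).1 h2).2.2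
  have hq : ContDiff ℝ 1 fun y => deriv (deriv ψ.lift) y / deriv ψ.lift y :=
    h1.div (h2.of_le (by norm_num)) fun x => (hF.deriv_pos x).ne'
  exact continuous_quot_lift _
    ((hq.continuous_deriv le_rfl).sub ((hq.continuous.pow 2).div_const 2))

/-- The measure `m` is quasi-invariant under `Diff³(𝕋)` with the Schwarzian cocycle. For
`s = 2 / σ²` this is the case `α = 0` of the defining property of an orbital measure. -/
def SchwarzianQuasiInvariant (s : ℝ) (m : Measure (CircleDiffeo 1)) : Prop :=
  ∀ (ψ : CircleDiffeo 3) (f : CircleDiffeo 1 → ℝ≥0∞), Measurable f →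
    ∫⁻ φ, f (ψ.postcomp φ) *
        ENNReal.ofReal (Real.exp (s / 2 * circlePairing ψ.schwarzian φ.speed)) ∂m
      = ∫⁻ φ, f φ ∂m

/-- The integral of the Boltzmann weight `exp(-s X)` against the law of the root `φ⁻¹(0)`, tested on
`g`. -/
def boltzmannIntegral (s : ℝ) (m : Measure (CircleDiffeo 1)) (g : C(UnitAddCircle, ℝ≥0))
    (X : CircleDiffeo 1 → ℝ) : ℝ≥0∞ :=
  ∫⁻ φ, g (φ.symm 0) * ENNReal.ofReal (Real.exp (-s * X φ)) ∂m

/-- The Laplace transform `∫ g(φ⁻¹(0)) exp(-s ∫ w(u) φ'(φ⁻¹(u)) du) dm(φ)` of the joint law of the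
root and the speed. -/
def laplaceFunctional (s : ℝ) (m : Measure (CircleDiffeo 1)) (g : C(UnitAddCircle, ℝ≥0))
    (w : UnitAddCircle → ℝ) : ℝ≥0∞ :=
  boltzmannIntegral s m g fun φ => circlePairing w φ.speed

theorem laplaceFunctional_const (s : ℝ) (m : Measure (CircleDiffeo 1)) (g : C(UnitAddCircle, ℝ≥0))
    (c : ℝ) :
    laplaceFunctional s m g (fun _ => c) = boltzmannIntegral s m g fun φ => c * φ.energy := by
  simp only [laplaceFunctional, circlePairing_const_speed]

theorem measurable_boltzmannIntegral_integrand (s : ℝ) (g : C(UnitAddCircle, ℝ≥0))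
    {X : CircleDiffeo 1 → ℝ} (hX : Measurable X) :
    Measurable fun φ : CircleDiffeo 1 =>
      (g (φ.symm 0) : ℝ≥0∞) * ENNReal.ofReal (Real.exp (-s * X φ)) :=
  (g.continuous.comp (continuous_symm_apply 0)).measurable.coe_nnreal_ennreal.mul
    (hX.const_mul (-s)).exp.ennreal_ofReal

theorem circlePairing_speed_of_schwarzian {ψ : CircleDiffeo 3} {w : UnitAddCircle → ℝ} {c : ℝ}
    (hw : ∀ u, ψ.schwarzian u - 2 * c * ψ.derivative u ^ 2 = -2 * w u) (φ : CircleDiffeo 1) :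
    circlePairing w φ.speed
      = c * (ψ.postcomp φ).energy - circlePairing ψ.schwarzian φ.speed / 2 := by
  have hd : Continuous fun u => ψ.derivative u ^ 2 :=
    (continuous_derivative_of_one_le (by norm_num) ψ).pow 2
  rw [energy_postcomp, circlePairing, circlePairing, ← integral_const_mul, ← integral_div,
    ← integral_sub]
  · refine integral_congr_ae (Eventually.of_forall fun u => ?_)
    linear_combination ((φ.speed u : ℝ) / 2) * hw u
  · exact integrable_of_continuous (by fun_prop)
  · exact integrable_of_continuous (((continuous_schwarzian ψ).mul (by fun_prop)).div_const 2)

theorem SchwarzianQuasiInvariant.laplaceFunctional_riccati {s : ℝ} {m : Measure (CircleDiffeo 1)}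
    (hm : SchwarzianQuasiInvariant s m) (g : C(UnitAddCircle, ℝ≥0))
    {r : ℝ → ℝ} (hr : ContDiff ℝ 1 r) (hp : Function.Periodic r 1) {β : ℝ}
    (hβ : ∫ x in (0 : ℝ)..1, r x = β) (hβ0 : 0 < β) {w : UnitAddCircle → ℝ}
    (hw : ∀ x : ℝ, w x = deriv r x + r x ^ 2) :
    laplaceFunctional s m g w = laplaceFunctional s m g fun _ => β ^ 2 := by
  obtain ⟨ψ, hψ0, hψ⟩ := exists_circleDiffeo_of_riccati hr hp hβ hβ0
  have hψw : ∀ u, ψ.schwarzian u - 2 * β ^ 2 * ψ.derivative u ^ 2 = -2 * w u := fun u => by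
    obtain ⟨x, rfl⟩ := QuotientAddGroup.mk_surjective u
    exact (hψ x).trans (by rw [← hw])
  rw [laplaceFunctional_const, boltzmannIntegral, ← hm ψ _
    (measurable_boltzmannIntegral_integrand s g (continuous_energy.measurable.const_mul _))]
  refine lintegral_congr fun φ => ?_
  rw [symm_postcomp, symm_apply_eq.2 hψ0.symm, mul_assoc, ← ENNReal.ofReal_mul (Real.exp_pos _).le,
    ← Real.exp_add]
  beta_reduce
  rw [circlePairing_speed_of_schwarzian hψw]
  ring_nf

/-! ### A periodic approximation of the unit mass at the integers -/

/-- The raised cosine: a `1`-periodic function with values in `[0, 1]`, equal to one exactly at the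
integers. Its powers are the unnormalised approximations of the unit mass. -/
def bumpBase (x : ℝ) : ℝ := (1 + Real.cos (2 * Real.pi * x)) / 2

/-- The powers of `bumpBase` normalised to have integral one over a period; they concentrate at the
integers. -/
def bump (n : ℕ) (x : ℝ) : ℝ :=
  (∫ y in (-(1 / 2) : ℝ)..(1 / 2), bumpBase y ^ n)⁻¹ * bumpBase x ^ n

/-- The primitive of `bump n` vanishing at `-1/2`, a smooth approximation of the step function
`x ↦ ⌊x⌋ + 1`. -/
def bumpPrimitive (n : ℕ) (x : ℝ) : ℝ := ∫ y in (-(1 / 2) : ℝ)..x, bump n y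

theorem continuous_bumpBase : Continuous bumpBase := by unfold bumpBase; fun_prop

theorem bumpBase_zero : bumpBase 0 = 1 := by simp [bumpBase]

theorem periodic_bumpBase : Function.Periodic bumpBase 1 := fun x => by
  rw [bumpBase, bumpBase, mul_add, mul_one, Real.cos_add_two_pi]

theorem bumpBase_neg (x : ℝ) : bumpBase (-x) = bumpBase x := by
  rw [bumpBase, bumpBase, mul_neg, Real.cos_neg]

theorem bumpBase_eq_cos_sq (x : ℝ) : bumpBase x = Real.cos (Real.pi * x) ^ 2 := by
  rw [bumpBase, Real.cos_sq, mul_assoc]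
  ring

theorem bumpBase_nonneg (x : ℝ) : 0 ≤ bumpBase x := by
  rw [bumpBase_eq_cos_sq]
  positivity

theorem bumpBase_pos {x : ℝ} (hx : x ∈ Set.Ioo (-(1 / 2) : ℝ) (1 / 2)) : 0 < bumpBase x := by
  rw [bumpBase_eq_cos_sq]
  exact pow_pos (Real.cos_pos_of_mem_Ioo
    ⟨by nlinarith [Real.pi_pos, hx.1], by nlinarith [Real.pi_pos, hx.2]⟩) 2

theorem bumpBase_lt_one {x : ℝ} (hx : x ∈ Set.Icc (-(1 / 2) : ℝ) (1 / 2)) (h0 : x ≠ 0) :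
    bumpBase x < 1 := by
  have hcos : Real.cos (2 * Real.pi * x) ≠ 1 := by
    rw [Ne, Real.cos_eq_one_iff_of_lt_of_lt (by nlinarith [Real.pi_pos, hx.1])
      (by nlinarith [Real.pi_pos, hx.2])]
    exact mul_ne_zero Real.two_pi_pos.ne' h0
  rw [bumpBase]
  linarith [lt_of_le_of_ne (Real.cos_le_one (2 * Real.pi * x)) hcos]

theorem continuous_bump (n : ℕ) : Continuous (bump n) :=
  continuous_const.mul (continuous_bumpBase.pow n)

theorem periodic_bump (n : ℕ) : Function.Periodic (bump n) 1 := fun x => by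
  rw [bump, bump, periodic_bumpBase]

theorem bump_neg (n : ℕ) (x : ℝ) : bump n (-x) = bump n x := by
  rw [bump, bump, bumpBase_neg]

theorem bump_nonneg (n : ℕ) (x : ℝ) : 0 ≤ bump n x :=
  mul_nonneg (inv_nonneg.2 (intervalIntegral.integral_nonneg (by norm_num)
    fun y _ => pow_nonneg (bumpBase_nonneg y) n)) (pow_nonneg (bumpBase_nonneg x) n)

theorem intervalIntegrable_bump (n : ℕ) (x y : ℝ) : IntervalIntegrable (bump n) volume x y :=
  (continuous_bump n).intervalIntegrable x y

theorem integral_bump (n : ℕ) : ∫ x in (-(1 / 2) : ℝ)..(1 / 2), bump n x = 1 := by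
  simp only [bump]
  rw [intervalIntegral.integral_const_mul]
  exact inv_mul_cancel₀ (intervalIntegral.intervalIntegral_pos_of_pos_on
    ((continuous_bumpBase.pow n).intervalIntegrable _ _)
    (fun x hx => pow_pos (bumpBase_pos hx) n) (by norm_num)).ne'

theorem tendsto_integral_bump_mul {g : ℝ → ℝ}
    (hg : IntegrableOn g (Set.Icc (-(1 / 2) : ℝ) (1 / 2))) (hc : ContinuousAt g 0) :
    Tendsto (fun n => ∫ x in (-(1 / 2) : ℝ)..(1 / 2), bump n x * g x) atTop (𝓝 (g 0)) := by
  have h := tendsto_setIntegral_pow_smul_of_unique_maximum_of_isCompact_of_integrableOn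
    (μ := volume) isCompact_Icc continuous_bumpBase.continuousOn
    (fun y hy h0 => (bumpBase_lt_one hy h0).trans_eq bumpBase_zero.symm)
    (fun x _ => bumpBase_nonneg x) (by rw [bumpBase_zero]; exact one_pos)
    (subset_closure (by rw [interior_Icc]; norm_num)) hg hc.continuousWithinAt
  refine h.congr fun n => ?_
  simp only [bump, mul_assoc, smul_eq_mul]
  rw [intervalIntegral.integral_const_mul, intervalIntegral.integral_of_le (by norm_num),
    intervalIntegral.integral_of_le (by norm_num), integral_Icc_eq_integral_Ioc,
    integral_Icc_eq_integral_Ioc]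

theorem tendsto_integral_mul_of_le_bump {D : ℕ → ℝ → ℝ} {C m : ℝ} (hD : ∀ n, Continuous (D n))
    (hD0 : ∀ n x, 0 ≤ D n x) (hDC : ∀ n x, D n x ≤ C * bump n x)
    (hm : Tendsto (fun n => ∫ x in (-(1 / 2) : ℝ)..(1 / 2), D n x) atTop (𝓝 m)) {q : ℝ → ℝ}
    (hq : Continuous q) :
    Tendsto (fun n => ∫ x in (-(1 / 2) : ℝ)..(1 / 2), D n x * q x) atTop (𝓝 (m * q 0)) := by
  have herr : Tendsto (fun n => ∫ x in (-(1 / 2) : ℝ)..(1 / 2), D n x * (q x - q 0)) atTop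
      (𝓝 0) := by
    have hosc : Continuous fun x => C * |q x - q 0| := by fun_prop
    have h := tendsto_integral_bump_mul (hosc.continuousOn.integrableOn_compact isCompact_Icc)
      hosc.continuousAt
    simp only [sub_self, abs_zero, mul_zero] at h
    refine squeeze_zero_norm (fun n => ?_) h
    refine (intervalIntegral.abs_integral_le_integral_abs (by norm_num)).trans
      (intervalIntegral.integral_mono_on (by norm_num) ?_ ?_ fun x _ => ?_)
    · exact ((hD n).mul (hq.sub continuous_const)).abs.intervalIntegrable _ _
    · exact ((continuous_bump n).mul hosc).intervalIntegrable _ _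
    · rw [abs_mul, abs_of_nonneg (hD0 n x), ← mul_assoc, mul_comm (bump n x)]
      exact mul_le_mul_of_nonneg_right (hDC n x) (abs_nonneg _)
  have hsum := herr.add (hm.mul_const (q 0))
  rw [zero_add] at hsum
  refine hsum.congr fun n => ?_
  have hDerr : Continuous fun x => D n x * (q x - q 0) := (hD n).mul (hq.sub continuous_const)
  have hD0 : Continuous fun x => D n x * q 0 := (hD n).mul continuous_const
  rw [← intervalIntegral.integral_mul_const, ← intervalIntegral.integral_add
    (hDerr.intervalIntegrable _ _) (hD0.intervalIntegrable _ _)]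
  simp only [← mul_add, sub_add_cancel]

theorem hasDerivAt_bumpPrimitive (n : ℕ) (x : ℝ) : HasDerivAt (bumpPrimitive n) (bump n x) x :=
  hasDerivAt_integral_of_continuous (continuous_bump n) _ x

theorem monotone_bumpPrimitive (n : ℕ) : Monotone (bumpPrimitive n) :=
  monotone_of_hasDerivAt_nonneg (hasDerivAt_bumpPrimitive n) (bump_nonneg n)

theorem bumpPrimitive_half (n : ℕ) : bumpPrimitive n (1 / 2) = 1 := integral_bump n

theorem bumpPrimitive_neg (n : ℕ) (x : ℝ) : bumpPrimitive n (-x) = 1 - bumpPrimitive n x := by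
  have hrefl : bumpPrimitive n (-x) = ∫ y in x..(1 / 2), bump n y := by
    rw [bumpPrimitive, ← intervalIntegral.integral_comp_neg]
    simp only [bump_neg]
  have hsum := intervalIntegral.integral_add_adjacent_intervals
    (intervalIntegrable_bump n (-(1 / 2)) x) (intervalIntegrable_bump n x (1 / 2))
  rw [integral_bump] at hsum
  rw [hrefl, bumpPrimitive]
  linarith

theorem bumpPrimitive_zero (n : ℕ) : bumpPrimitive n 0 = 1 / 2 := by
  have h := bumpPrimitive_neg n 0
  rw [neg_zero] at h
  linarith

theorem bumpPrimitive_add_one (n : ℕ) (x : ℝ) :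
    bumpPrimitive n (x + 1) = bumpPrimitive n x + 1 := by
  have hperiod := (periodic_bump n).intervalIntegral_add_eq x (-(1 / 2))
  rw [show (-(1 / 2) : ℝ) + 1 = 1 / 2 by norm_num, integral_bump] at hperiod
  have hsum := intervalIntegral.integral_add_adjacent_intervals
    (intervalIntegrable_bump n (-(1 / 2)) x) (intervalIntegrable_bump n x (x + 1))
  rw [bumpPrimitive, ← hsum, hperiod, bumpPrimitive]

theorem tendsto_bumpPrimitive_of_le_half {x : ℝ} (h0 : 0 < x) (hx : x ≤ 1 / 2) :
    Tendsto (fun n => bumpPrimitive n x) atTop (𝓝 1) := by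
  have h := tendsto_integral_bump_mul (g := (Set.Iic x).indicator 1)
    ((integrableOn_const (by simp)).indicator measurableSet_Iic)
    (continuousAt_const.congr (((Set.eqOn_indicator (s := Set.Iic x) (f := (1 : ℝ → ℝ))).symm
      |>.eventuallyEq_of_mem (Iic_mem_nhds h0))))
  rw [Set.indicator_of_mem (Set.mem_Iic.2 h0.le), Pi.one_apply] at h
  refine h.congr fun n => ?_
  simp only [← Set.indicator_mul_right, Pi.one_apply, mul_one]
  rw [bumpPrimitive, intervalIntegral.integral_of_le (by norm_num),
    intervalIntegral.integral_of_le (by linarith), setIntegral_indicator measurableSet_Iic,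
    Set.Ioc_inter_Iic, min_eq_right hx]

theorem tendsto_bumpPrimitive {x : ℝ} (hx : x ∈ Set.Ioo (0 : ℝ) 1) :
    Tendsto (fun n => bumpPrimitive n x) atTop (𝓝 1) := by
  rcases le_total x (1 / 2) with hle | hge
  · exact tendsto_bumpPrimitive_of_le_half hx.1 hle
  · have hrefl : ∀ n, bumpPrimitive n x = 2 - bumpPrimitive n (1 - x) := fun n => by
      rw [show 1 - x = -x + 1 by ring, bumpPrimitive_add_one, bumpPrimitive_neg]
      ring
    have h := (tendsto_bumpPrimitive_of_le_half (x := 1 - x) (by linarith [hx.2])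
      (by linarith)).const_sub 2
    norm_num at h
    simpa only [hrefl] using h

/-! ### Riccati solutions approximating a point interaction -/

/-- A periodic function of slope `b` off the integers with an approximate jump of `-b` there: in the
limit it runs linearly from `a - b` to `a` over `(0, 1)`. -/
def phase (a b : ℝ) (n : ℕ) (x : ℝ) : ℝ := a + b * (x - bumpPrimitive n x)

theorem hasDerivAt_phase (a b : ℝ) (n : ℕ) (x : ℝ) :
    HasDerivAt (phase a b n) (b * (1 - bump n x)) x :=
  (((hasDerivAt_id x).sub (hasDerivAt_bumpPrimitive n x)).const_mul b).const_add a

theorem continuous_phase (a b : ℝ) (n : ℕ) : Continuous (phase a b n) :=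
  continuous_iff_continuousAt.2 fun x => (hasDerivAt_phase a b n x).continuousAt

theorem periodic_phase (a b : ℝ) (n : ℕ) : Function.Periodic (phase a b n) 1 := fun x => by
  rw [phase, phase, bumpPrimitive_add_one]; ring

theorem le_phase {b : ℝ} (hb : 0 ≤ b) (a : ℝ) (n : ℕ) (x : ℝ) : a - b ≤ phase a b n x := by
  obtain ⟨y, hy, hxy⟩ := (periodic_phase a b n).exists_mem_Ico (by norm_num) x (-(1 / 2))
  have hbound : -1 ≤ y - bumpPrimitive n y := by
    rcases le_total y 0 with h | h
    · linarith [hy.1, (monotone_bumpPrimitive n h).trans_eq (bumpPrimitive_zero n)]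
    · linarith [(monotone_bumpPrimitive n (show y ≤ 1 / 2 by linarith [hy.2])).trans_eq
        (bumpPrimitive_half n)]
  rw [hxy, phase]
  nlinarith

theorem tendsto_phase (a b : ℝ) {x : ℝ} (hx : x ∈ Set.Ioo (0 : ℝ) 1) :
    Tendsto (fun n => phase a b n x) atTop (𝓝 (a + b * (x - 1))) :=
  ((tendsto_const_nhds.sub (tendsto_bumpPrimitive hx)).const_mul b).const_add a

theorem tendsto_integral_comp_phase {a b C : ℝ} (hb : 0 < b) {h : ℝ → ℝ}
    (hc : ContinuousOn h (Set.Ici (a - b))) (hC : ∀ x ∈ Set.Ici (a - b), |h x| ≤ C) :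
    Tendsto (fun n => ∫ x in (0 : ℝ)..1, h (phase a b n x)) atTop
      (𝓝 (b⁻¹ * ∫ y in (a - b)..a, h y)) := by
  have hlim : ∫ x in (0 : ℝ)..1, h (a + b * (x - 1)) = b⁻¹ * ∫ y in (a - b)..a, h y := by
    have hshift := intervalIntegral.integral_comp_add_mul h hb.ne' (a - b) (a := 0) (b := 1)
    rw [mul_zero, mul_one, add_zero, sub_add_cancel, smul_eq_mul] at hshift
    rw [← hshift]
    exact intervalIntegral.integral_congr fun x _ => congrArg h (by ring)
  rw [← hlim]
  refine intervalIntegral.tendsto_integral_filter_of_dominated_convergence (fun _ => C)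
    (Eventually.of_forall fun n => (hc.comp_continuous (continuous_phase a b n)
      (le_phase hb.le a n)).aestronglyMeasurable)
    (Eventually.of_forall fun n => Eventually.of_forall fun x _ => hC _ (le_phase hb.le a n x))
    intervalIntegrable_const ?_
  filter_upwards [compl_mem_ae_iff.2 (measure_singleton (1 : ℝ))] with x hx1 hx
  rw [Set.uIoc_of_le zero_le_one] at hx
  have hphase := tendsto_phase a b ⟨hx.1, lt_of_le_of_ne hx.2 hx1⟩
  exact (hc _ (ge_of_tendsto' hphase fun n => le_phase hb.le a n x)).tendsto.comp
    (tendsto_nhdsWithin_iff.2 ⟨hphase, Eventually.of_forall fun n => le_phase hb.le a n x⟩)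

theorem hasDerivAt_coth {x : ℝ} (hx : Real.sinh x ≠ 0) :
    HasDerivAt (fun x => Real.cosh x / Real.sinh x) (-(1 / Real.sinh x ^ 2)) x := by
  convert! (Real.hasDerivAt_cosh x).div (Real.hasDerivAt_sinh x) hx using 1
  field_simp
  linarith [Real.cosh_sq x]

theorem continuousOn_coth {c : ℝ} (hc : 0 < c) :
    ContinuousOn (fun y => Real.cosh y / Real.sinh y) (Set.Ici c) := fun _ hx =>
  (hasDerivAt_coth (Real.sinh_pos_iff.2 (hc.trans_le hx)).ne').continuousAt.continuousWithinAt

theorem coth_le {c x : ℝ} (hc : 0 < c) (hx : c ≤ x) :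
    Real.cosh x / Real.sinh x ≤ 1 + 1 / Real.sinh c := by
  have hs : 0 < Real.sinh c := Real.sinh_pos_iff.2 hc
  have hsx : Real.sinh c ≤ Real.sinh x := Real.sinh_le_sinh.2 hx
  have hcosh : Real.cosh x ≤ Real.sinh x + 1 := by
    linarith [Real.cosh_sub_sinh x, Real.exp_le_one_iff.2 (by linarith : -x ≤ 0)]
  calc Real.cosh x / Real.sinh x ≤ (Real.sinh x + 1) / Real.sinh x :=
        div_le_div_of_nonneg_right hcosh (hs.le.trans hsx)
    _ = 1 + 1 / Real.sinh x := by rw [add_div, div_self (hs.trans_le hsx).ne']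
    _ ≤ 1 + 1 / Real.sinh c := by gcongr

theorem integral_coth {c a : ℝ} (hc : 0 < c) (hca : c ≤ a) :
    ∫ y in c..a, Real.cosh y / Real.sinh y = Real.log (Real.sinh a / Real.sinh c) := by
  have hpos : ∀ {x}, c ≤ x → 0 < Real.sinh x := fun hx => Real.sinh_pos_iff.2 (hc.trans_le hx)
  have hmem : Set.uIcc c a ⊆ Set.Ici c := by
    rw [Set.uIcc_of_le hca]
    exact Set.Icc_subset_Ici_self
  rw [Real.log_div (hpos hca).ne' (hpos le_rfl).ne']
  exact intervalIntegral.integral_eq_sub_of_hasDerivAt (f := fun y => Real.log (Real.sinh y))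
    (fun x hx => (Real.hasDerivAt_sinh x).log (hpos (hmem hx)).ne')
    ((continuousOn_coth hc).mono hmem).intervalIntegrable

theorem continuousOn_one_div_sinh_sq {c : ℝ} (hc : 0 < c) :
    ContinuousOn (fun y => 1 / Real.sinh y ^ 2) (Set.Ici c) :=
  continuousOn_const.div (Real.continuous_sinh.continuousOn.pow 2) fun _ hx =>
    pow_ne_zero 2 (Real.sinh_pos_iff.2 (hc.trans_le hx)).ne'

theorem one_div_sinh_sq_le {c x : ℝ} (hc : 0 < c) (hx : c ≤ x) :
    1 / Real.sinh x ^ 2 ≤ 1 / Real.sinh c ^ 2 := by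
  have := Real.sinh_pos_iff.2 hc
  have := Real.sinh_le_sinh.2 hx
  gcongr

theorem integral_one_div_sinh_sq {c a : ℝ} (hc : 0 < c) (hca : c ≤ a) :
    ∫ y in c..a, 1 / Real.sinh y ^ 2
      = Real.cosh c / Real.sinh c - Real.cosh a / Real.sinh a := by
  have hmem : Set.uIcc c a ⊆ Set.Ici c := by
    rw [Set.uIcc_of_le hca]
    exact Set.Icc_subset_Ici_self
  have h := intervalIntegral.integral_eq_sub_of_hasDerivAt
    (fun x hx => hasDerivAt_coth (Real.sinh_pos_iff.2 (hc.trans_le (hmem hx))).ne')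
    ((continuousOn_one_div_sinh_sq hc).mono hmem).neg.intervalIntegrable
  rw [intervalIntegral.integral_neg] at h
  linarith

/-- The Riccati solution `b coth` of the phase. For a phase of constant slope `b` its potential
`r' + r²` would be `b²`; the jumps of the phase add point masses at the integers. -/
def pointRiccati (a b : ℝ) (n : ℕ) (x : ℝ) : ℝ :=
  b * (Real.cosh (phase a b n x) / Real.sinh (phase a b n x))

/-- The part of the potential of `pointRiccati` concentrating at the integers. -/
def pointSource (a b : ℝ) (n : ℕ) (x : ℝ) : ℝ :=
  b ^ 2 * bump n x * (1 / Real.sinh (phase a b n x) ^ 2)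

/-- The potential `r' + r²` of `r = pointRiccati a b n`. -/
def pointPotential (a b : ℝ) (n : ℕ) (x : ℝ) : ℝ := b ^ 2 + pointSource a b n x

/-- The limiting mass of `pointSource a b n` at an integer. -/
def pointStrength (a b : ℝ) : ℝ :=
  b * (Real.cosh (a - b) / Real.sinh (a - b) - Real.cosh a / Real.sinh a)

theorem periodic_pointRiccati (a b : ℝ) (n : ℕ) : Function.Periodic (pointRiccati a b n) 1 :=
  fun x => by rw [pointRiccati, pointRiccati, periodic_phase]

theorem periodic_pointSource (a b : ℝ) (n : ℕ) : Function.Periodic (pointSource a b n) 1 :=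
  fun x => by rw [pointSource, pointSource, periodic_phase, periodic_bump]

theorem periodic_pointPotential (a b : ℝ) (n : ℕ) : Function.Periodic (pointPotential a b n) 1 :=
  fun x => by rw [pointPotential, pointPotential, periodic_pointSource]

theorem pointSource_nonneg (a b : ℝ) (n : ℕ) (x : ℝ) : 0 ≤ pointSource a b n x :=
  mul_nonneg (mul_nonneg (sq_nonneg b) (bump_nonneg n x)) (by positivity)

theorem le_pointPotential (a b : ℝ) (n : ℕ) (x : ℝ) : b ^ 2 ≤ pointPotential a b n x :=
  le_add_of_nonneg_right (pointSource_nonneg a b n x)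

section PointInteraction

variable {a b : ℝ} (hb : 0 < b) (hab : b < a) (n : ℕ) (x : ℝ)
include hb hab

theorem sinh_phase_pos : 0 < Real.sinh (phase a b n x) :=
  Real.sinh_pos_iff.2 ((sub_pos.2 hab).trans_le (le_phase hb.le a n x))

theorem continuous_one_div_sinh_phase_sq :
    Continuous fun x => 1 / Real.sinh (phase a b n x) ^ 2 :=
  (continuousOn_one_div_sinh_sq (sub_pos.2 hab)).comp_continuous (continuous_phase a b n)
    (le_phase hb.le a n)

theorem continuous_pointSource : Continuous (pointSource a b n) :=
  (continuous_const.mul (continuous_bump n)).mul (continuous_one_div_sinh_phase_sq hb hab n)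

theorem continuous_pointPotential : Continuous (pointPotential a b n) :=
  continuous_const.add (continuous_pointSource hb hab n)

theorem pointSource_le : pointSource a b n x ≤ b ^ 2 * (1 / Real.sinh (a - b) ^ 2) * bump n x := by
  rw [mul_right_comm]
  exact mul_le_mul_of_nonneg_left (one_div_sinh_sq_le (sub_pos.2 hab) (le_phase hb.le a n x))
    (mul_nonneg (sq_nonneg b) (bump_nonneg n x))

theorem hasDerivAt_pointRiccati :
    HasDerivAt (pointRiccati a b n)
      (pointSource a b n x - b ^ 2 * (1 / Real.sinh (phase a b n x) ^ 2)) x := by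
  convert! ((hasDerivAt_coth (sinh_phase_pos hb hab n x).ne').comp x
    (hasDerivAt_phase a b n x)).const_mul b using 1
  rw [pointSource]
  ring

theorem continuous_pointRiccati : Continuous (pointRiccati a b n) :=
  continuous_iff_continuousAt.2 fun x => (hasDerivAt_pointRiccati hb hab n x).continuousAt

theorem contDiff_pointRiccati : ContDiff ℝ 1 (pointRiccati a b n) := by
  exact_mod_cast contDiff_succ_of_hasDerivAt (n := 0) (hasDerivAt_pointRiccati hb hab n)
    (contDiff_zero.2 ((continuous_pointSource hb hab n).sub
      (continuous_const.mul (continuous_one_div_sinh_phase_sq hb hab n))))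

theorem deriv_pointRiccati_add_sq :
    deriv (pointRiccati a b n) x + pointRiccati a b n x ^ 2 = pointPotential a b n x := by
  rw [(hasDerivAt_pointRiccati hb hab n x).deriv, pointPotential, pointRiccati]
  have := (sinh_phase_pos hb hab n x).ne'
  field_simp
  rw [Real.cosh_sq]
  ring

theorem le_integral_pointRiccati : b ≤ ∫ x in (0 : ℝ)..1, pointRiccati a b n x := by
  have h : ∫ _ in (0 : ℝ)..1, b ≤ ∫ x in (0 : ℝ)..1, pointRiccati a b n x :=
    intervalIntegral.integral_mono_on zero_le_one intervalIntegrable_const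
      ((continuous_pointRiccati hb hab n).intervalIntegrable _ _) fun x _ =>
      le_mul_of_one_le_right hb.le
        ((one_le_div (sinh_phase_pos hb hab n x)).2 (Real.sinh_lt_cosh _).le)
  simpa using h

theorem tendsto_integral_pointRiccati :
    Tendsto (fun n => ∫ x in (0 : ℝ)..1, pointRiccati a b n x) atTop
      (𝓝 (Real.log (Real.sinh a / Real.sinh (a - b)))) := by
  have hc : 0 < a - b := sub_pos.2 hab
  have h := tendsto_integral_comp_phase hb (continuousOn_coth hc) fun x hx => by
    rw [abs_of_pos (div_pos (Real.cosh_pos x) (Real.sinh_pos_iff.2 (hc.trans_le hx)))]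
    exact coth_le hc hx
  rw [integral_coth hc (by linarith)] at h
  simpa only [pointRiccati, intervalIntegral.integral_const_mul, mul_inv_cancel_left₀ hb.ne']
    using h.const_mul b

/-- A periodic Riccati solution `r` has `∫ r' = 0`, so the source has the same mass as
`b² / sinh²` of the phase. -/
theorem integral_pointSource :
    ∫ x in (-(1 / 2) : ℝ)..(1 / 2), pointSource a b n x
      = b ^ 2 * ∫ x in (0 : ℝ)..1, 1 / Real.sinh (phase a b n x) ^ 2 := by
  have hS := (continuous_pointSource hb hab n).intervalIntegrable (μ := volume) 0 1
  have hI : IntervalIntegrable (fun x => b ^ 2 * (1 / Real.sinh (phase a b n x) ^ 2)) volume 0 1 :=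
    (continuous_const.mul (continuous_one_div_sinh_phase_sq hb hab n)).intervalIntegrable _ _
  have hzero := intervalIntegral.integral_eq_sub_of_hasDerivAt
    (fun x _ => hasDerivAt_pointRiccati hb hab n x) (hS.sub hI)
  have hperiod := (periodic_pointRiccati a b n).eq
  rw [intervalIntegral.integral_sub hS hI, hperiod, sub_self,
    intervalIntegral.integral_const_mul] at hzero
  have hshift := (periodic_pointSource a b n).intervalIntegral_add_eq (-(1 / 2)) 0
  norm_num only at hshift
  rw [hshift, sub_eq_zero.1 hzero]

theorem tendsto_integral_pointSource :
    Tendsto (fun n => ∫ x in (-(1 / 2) : ℝ)..(1 / 2), pointSource a b n x) atTop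
      (𝓝 (pointStrength a b)) := by
  have hc : 0 < a - b := sub_pos.2 hab
  have h := tendsto_integral_comp_phase hb (continuousOn_one_div_sinh_sq hc) fun x hx => by
    rw [abs_of_nonneg (by positivity)]
    exact one_div_sinh_sq_le hc hx
  rw [integral_one_div_sinh_sq hc (by linarith)] at h
  have hstrength : b ^ 2 * (b⁻¹ * (Real.cosh (a - b) / Real.sinh (a - b)
      - Real.cosh a / Real.sinh a)) = pointStrength a b := by
    rw [pointStrength, sq, mul_assoc, mul_inv_cancel_left₀ hb.ne']
  simp only [integral_pointSource hb hab, ← hstrength]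
  exact h.const_mul (b ^ 2)

theorem tendsto_integral_pointPotential {q : ℝ → ℝ} (hq : Continuous q) :
    Tendsto (fun n => ∫ x in (-(1 / 2) : ℝ)..(1 / 2), pointPotential a b n x * q x) atTop
      (𝓝 (b ^ 2 * (∫ x in (-(1 / 2) : ℝ)..(1 / 2), q x) + pointStrength a b * q 0)) := by
  have h := tendsto_integral_mul_of_le_bump (continuous_pointSource hb hab)
    (pointSource_nonneg a b) (pointSource_le hb hab) (tendsto_integral_pointSource hb hab) hq
  refine (h.const_add _).congr fun n => ?_
  have hbase : Continuous fun x => b ^ 2 * q x := continuous_const.mul hq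
  have hsource : Continuous fun x => pointSource a b n x * q x :=
    (continuous_pointSource hb hab n).mul hq
  rw [← intervalIntegral.integral_const_mul, ← intervalIntegral.integral_add
    (hbase.intervalIntegrable _ _) (hsource.intervalIntegrable _ _)]
  simp only [pointPotential, add_mul]

end PointInteraction

/-! ### The Laplace functional of a point interaction -/

theorem exists_forall_apply_le {X : Type*} [TopologicalSpace X] [CompactSpace X] (g : C(X, ℝ≥0)) :
    ∃ C : ℝ≥0, ∀ x, g x ≤ C := by
  obtain ⟨C, hC⟩ := (isCompact_range g.continuous).bddAbove
  exact ⟨C, fun x => hC ⟨x, rfl⟩⟩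

section FinitePartitionFunction

variable {s : ℝ} {m : Measure (CircleDiffeo 1)} {b₀ : ℝ} (hs : 0 ≤ s)
  (hfin : laplaceFunctional s m 1 (fun _ => b₀ ^ 2) < ∞) (g : C(UnitAddCircle, ℝ≥0))
include hs hfin

theorem boltzmannIntegral_lt_top {X : CircleDiffeo 1 → ℝ} (hX : ∀ φ, b₀ ^ 2 * φ.energy ≤ X φ) :
    boltzmannIntegral s m g X < ∞ := by
  obtain ⟨C, hC⟩ := exists_forall_apply_le g
  calc boltzmannIntegral s m g X
      ≤ ∫⁻ φ, C * ENNReal.ofReal (Real.exp (-s * (b₀ ^ 2 * φ.energy))) ∂m := by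
        refine lintegral_mono fun φ => mul_le_mul' (ENNReal.coe_le_coe.2 (hC _))
          (ENNReal.ofReal_le_ofReal (Real.exp_le_exp.2 ?_))
        nlinarith [hX φ]
    _ = C * laplaceFunctional s m 1 (fun _ => b₀ ^ 2) := by
        rw [lintegral_const_mul' _ _ ENNReal.coe_ne_top, laplaceFunctional_const]
        simp only [boltzmannIntegral, ContinuousMap.one_apply, ENNReal.coe_one, one_mul]
    _ < ∞ := ENNReal.mul_lt_top ENNReal.coe_lt_top hfin

theorem tendsto_boltzmannIntegral {ι : Type*} {l : Filter ι} [l.IsCountablyGenerated]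
    {X : ι → CircleDiffeo 1 → ℝ} {Y : CircleDiffeo 1 → ℝ} (hm : ∀ i, Measurable (X i))
    (hX : ∀ᶠ i in l, ∀ φ, b₀ ^ 2 * φ.energy ≤ X i φ)
    (hlim : ∀ φ, Tendsto (fun i => X i φ) l (𝓝 (Y φ))) :
    Tendsto (fun i => boltzmannIntegral s m g (X i)) l (𝓝 (boltzmannIntegral s m g Y)) := by
  refine tendsto_lintegral_filter_of_dominated_convergence
    (fun φ => (g (φ.symm 0) : ℝ≥0∞) *
      ENNReal.ofReal (Real.exp (-s * (b₀ ^ 2 * φ.energy))))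
    (Eventually.of_forall fun i => measurable_boltzmannIntegral_integrand s g (hm i)) ?_
    (boltzmannIntegral_lt_top hs hfin g fun _ => le_rfl).ne
    (Eventually.of_forall fun φ => ENNReal.Tendsto.const_mul (ENNReal.tendsto_ofReal
      ((Real.continuous_exp.tendsto _).comp ((hlim φ).const_mul (-s))))
      (Or.inr ENNReal.coe_ne_top))
  filter_upwards [hX] with i hi
  refine Eventually.of_forall fun φ =>
    mul_le_mul' le_rfl (ENNReal.ofReal_le_ofReal (Real.exp_le_exp.2 ?_))
  nlinarith [hi φ]

variable (hb₀ : 0 < b₀)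
include hb₀

theorem laplaceFunctional_const_lt_top {b : ℝ} (hb : b₀ ≤ b) :
    laplaceFunctional s m g (fun _ => b ^ 2) < ∞ := by
  rw [laplaceFunctional_const]
  refine boltzmannIntegral_lt_top hs hfin g fun φ => ?_
  have := φ.energy_nonneg
  gcongr

theorem tendsto_laplaceFunctional_const {ι : Type*} {l : Filter ι} [l.IsCountablyGenerated]
    {β : ι → ℝ} {b : ℝ} (hβ : ∀ᶠ i in l, b₀ ≤ β i) (hlim : Tendsto β l (𝓝 b)) :
    Tendsto (fun i => laplaceFunctional s m g (fun _ => β i ^ 2)) l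
      (𝓝 (laplaceFunctional s m g (fun _ => b ^ 2))) := by
  simp only [laplaceFunctional_const]
  refine tendsto_boltzmannIntegral hs hfin g (fun i => continuous_energy.measurable.const_mul _) ?_
    fun φ => (hlim.pow 2).mul_const _
  filter_upwards [hβ] with i hi φ
  have := φ.energy_nonneg
  gcongr

end FinitePartitionFunction

/-- The function on the circle induced by `pointPotential`. -/
def circlePointPotential (a b : ℝ) (n : ℕ) : UnitAddCircle → ℝ :=
  (periodic_pointPotential a b n).lift

theorem continuous_circlePointPotential {a b : ℝ} (hb : 0 < b) (hab : b < a) (n : ℕ) :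
    Continuous (circlePointPotential a b n) :=
  continuous_quot_lift _ (continuous_pointPotential hb hab n)

theorem le_circlePointPotential (a b : ℝ) (n : ℕ) (u : UnitAddCircle) :
    b ^ 2 ≤ circlePointPotential a b n u := by
  obtain ⟨x, rfl⟩ := QuotientAddGroup.mk_surjective u
  exact le_pointPotential a b n x

theorem mul_energy_le_circlePairing {w : UnitAddCircle → ℝ} (hw : Continuous w) {c : ℝ}
    (hc : ∀ u, c ≤ w u) (φ : CircleDiffeo 1) : c * φ.energy ≤ circlePairing w φ.speed := by
  rw [← circlePairing_const_speed]
  exact integral_mono (integrable_of_continuous (by fun_prop))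
    (integrable_of_continuous (by fun_prop)) fun u =>
    mul_le_mul_of_nonneg_right (hc u) (φ.speed u).coe_nonneg

theorem tendsto_circlePairing_circlePointPotential {a b : ℝ} (hb : 0 < b) (hab : b < a)
    (φ : CircleDiffeo 1) :
    Tendsto (fun n => circlePairing (circlePointPotential a b n) φ.speed) atTop
      (𝓝 (b ^ 2 * φ.energy + pointStrength a b * φ.speed 0)) := by
  have hcircle : ∀ f : UnitAddCircle → ℝ, ∫ x in (-(1 / 2) : ℝ)..(1 / 2), f x = ∫ u, f u :=
    fun f => by
      rw [← UnitAddCircle.intervalIntegral_preimage (-(1 / 2)) f]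
      norm_num
  have h := tendsto_integral_pointPotential hb hab
    (q := fun x : ℝ => (φ.speed (x : UnitAddCircle) : ℝ))
    (NNReal.continuous_coe.comp (φ.speed.continuous.comp (AddCircle.continuous_mk' 1)))
  rw [hcircle fun u => (φ.speed u : ℝ), ← energy_eq] at h
  exact h.congr fun n => hcircle fun u => circlePointPotential a b n u * φ.speed u

theorem exists_sinh_eq {b β : ℝ} (hb : 0 < b) (hβ : b < β) :
    ∃ a, b < a ∧ Real.sinh a = Real.exp β * Real.sinh (a - b) := by
  set p := Real.exp β - Real.exp (-b)
  set q := Real.exp β - Real.exp b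
  have hq : 0 < q := sub_pos.2 (Real.exp_lt_exp.2 hβ)
  have hqp : q < p := sub_lt_sub_left (Real.exp_lt_exp.2 (by linarith)) _
  set x := Real.log (p / q) / 2 with hx
  have hx0 : 0 < x := half_pos (Real.log_pos ((one_lt_div hq).2 hqp))
  have hxpq : Real.exp x * Real.exp x * q = p := by
    rw [← Real.exp_add, hx, add_halves, Real.exp_log (div_pos (hq.trans hqp) hq),
      div_mul_cancel₀ _ hq.ne']
  refine ⟨x + b, by linarith, ?_⟩
  rw [add_sub_cancel_right, Real.sinh_eq, Real.sinh_eq, neg_add, Real.exp_add, Real.exp_add,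
    Real.exp_neg x]
  have := (Real.exp_pos x).ne'
  field_simp
  linear_combination -hxpq

theorem pointStrength_eq {a b β : ℝ} (hb : 0 < b) (hab : b < a)
    (h : Real.sinh a = Real.exp β * Real.sinh (a - b)) :
    pointStrength a b = 2 * b / Real.sinh b * (Real.cosh β - Real.cosh b) := by
  have hsb : 0 < Real.sinh b := Real.sinh_pos_iff.2 hb
  have hsa : 0 < Real.sinh a := Real.sinh_pos_iff.2 (hb.trans hab)
  have hsab : 0 < Real.sinh (a - b) := Real.sinh_pos_iff.2 (sub_pos.2 hab)
  have hcoth_sub :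
      Real.cosh (a - b) / Real.sinh (a - b) = (Real.exp β - Real.cosh b) / Real.sinh b := by
    have hadd := Real.sinh_add (a - b) b
    rw [sub_add_cancel] at hadd
    rw [div_eq_div_iff hsab.ne' hsb.ne']
    linear_combination h - hadd
  have hcoth : Real.cosh a / Real.sinh a = (Real.cosh b - Real.exp (-β)) / Real.sinh b := by
    have h' : Real.sinh (a - b) = Real.exp (-β) * Real.sinh a := by
      rw [h, ← mul_assoc, ← Real.exp_add, neg_add_cancel, Real.exp_zero, one_mul]
    rw [div_eq_div_iff hsa.ne' hsb.ne']
    linear_combination Real.sinh_sub a b - h'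
  rw [pointStrength, hcoth_sub, hcoth, Real.cosh_eq β]
  field_simp
  ring

theorem lintegral_sinh_mul_exp {b c : ℝ} (hb : 0 ≤ b) (hc : 0 < c) :
    ∫⁻ β in Set.Ioi b, ENNReal.ofReal (Real.sinh β) *
        ENNReal.ofReal (Real.exp (-c * (Real.cosh β - Real.cosh b)))
      = ENNReal.ofReal (1 / c) := by
  set F : ℝ → ℝ := fun β => -(1 / c) * Real.exp (-c * (Real.cosh β - Real.cosh b))
  have hF : ∀ x ∈ Set.Ici b,
      HasDerivAt F (Real.sinh x * Real.exp (-c * (Real.cosh x - Real.cosh b))) x := fun x _ => by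
    convert! ((((Real.hasDerivAt_cosh x).sub_const (Real.cosh b)).const_mul (-c)).exp).const_mul
      (-(1 / c)) using 1
    field_simp
  have hsinh : ∀ x ∈ Set.Ioi b, 0 ≤ Real.sinh x := fun x hx =>
    (Real.sinh_pos_iff.2 (hb.trans_lt hx)).le
  have hpos : ∀ x ∈ Set.Ioi b, 0 ≤ Real.sinh x * Real.exp (-c * (Real.cosh x - Real.cosh b)) :=
    fun x hx => mul_nonneg (hsinh x hx) (Real.exp_pos _).le
  have hlim : Tendsto F atTop (𝓝 0) := by
    have hcosh : Tendsto Real.cosh atTop atTop := by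
      refine tendsto_atTop_mono (fun x => ?_) (Real.tendsto_exp_atTop.atTop_div_const two_pos)
      rw [Real.cosh_eq]
      linarith [Real.exp_pos (-x)]
    have hexponent : Tendsto (fun β => -c * (Real.cosh β - Real.cosh b)) atTop atBot :=
      (tendsto_atTop_add_const_right _ (-Real.cosh b) hcosh).const_mul_atTop_of_neg
        (neg_lt_zero.2 hc)
    simpa [F, Function.comp_def] using (Real.tendsto_exp_atBot.comp hexponent).const_mul (-(1 / c))
  rw [setLIntegral_congr_fun measurableSet_Ioi fun x hx => (ENNReal.ofReal_mul (hsinh x hx)).symm,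
    ← ofReal_integral_eq_lintegral_ofReal (integrableOn_Ioi_deriv_of_nonneg' hF hpos hlim)
    ((ae_restrict_mem measurableSet_Ioi).mono hpos),
    integral_Ioi_of_hasDerivAt_of_nonneg' hF hpos hlim]
  simp [F]

theorem lintegral_sinh_mul_exp_pointInteraction {s b q : ℝ} (hs : 0 < s) (hb : 0 < b) (hq : 0 < q)
    (E : ℝ) :
    ∫⁻ β in Set.Ioi b, ENNReal.ofReal (Real.sinh β) * ENNReal.ofReal (Real.exp (-s *
        (b ^ 2 * E + 2 * b / Real.sinh b * (Real.cosh β - Real.cosh b) * q)))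
      = ENNReal.ofReal (Real.sinh b / (2 * s * b)) *
        (ENNReal.ofReal (1 / q) * ENNReal.ofReal (Real.exp (-s * (b ^ 2 * E)))) := by
  have := Real.sinh_pos_iff.2 hb
  have hsplit : ∀ β, ENNReal.ofReal (Real.sinh β) * ENNReal.ofReal (Real.exp (-s *
        (b ^ 2 * E + 2 * b / Real.sinh b * (Real.cosh β - Real.cosh b) * q)))
      = ENNReal.ofReal (Real.exp (-s * (b ^ 2 * E))) * (ENNReal.ofReal (Real.sinh β) *
        ENNReal.ofReal (Real.exp (-(s * (2 * b / Real.sinh b) * q) *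
          (Real.cosh β - Real.cosh b)))) := fun β => by
    rw [mul_left_comm, ← ENNReal.ofReal_mul (Real.exp_pos _).le, ← Real.exp_add]
    ring_nf
  simp only [hsplit]
  rw [lintegral_const_mul' _ _ ENNReal.ofReal_ne_top, lintegral_sinh_mul_exp hb.le (by positivity),
    show 1 / (s * (2 * b / Real.sinh b) * q) = Real.sinh b / (2 * s * b) * (1 / q) by field_simp,
    ENNReal.ofReal_mul (by positivity)]
  ring

/-! ### Rotations -/

theorem speed_postcomp_rotation (τ u : UnitAddCircle) (φ : CircleDiffeo 1) :
    ((rotation 3 τ).postcomp φ).speed u = φ.speed (u - τ) := by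
  have hsymm : (rotation 3 τ).symm u = u - τ := symm_apply_eq.2 (sub_add_cancel u τ).symm
  ext
  rw [coe_speed, coe_speed, symm_postcomp, hsymm, postcomp, derivative_comp, derivative_rotation,
    one_mul]

theorem energy_postcomp_rotation (τ : UnitAddCircle) (φ : CircleDiffeo 1) :
    ((rotation 3 τ).postcomp φ).energy = φ.energy := by
  rw [energy_postcomp, energy_eq]
  simp only [derivative_rotation, one_pow, one_mul]

theorem symm_postcomp_rotation_zero (τ : UnitAddCircle) (φ : CircleDiffeo 1) :
    ((rotation 3 τ).postcomp φ).symm 0 = φ.symm (-τ) := by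
  have hsymm : (rotation 3 τ).symm 0 = -τ := symm_apply_eq.2 (neg_add_cancel τ).symm
  rw [symm_postcomp, hsymm]

theorem SchwarzianQuasiInvariant.lintegral_rotation {s : ℝ} {m : Measure (CircleDiffeo 1)}
    (hm : SchwarzianQuasiInvariant s m) (τ : UnitAddCircle) {f : CircleDiffeo 1 → ℝ≥0∞}
    (hf : Measurable f) :
    ∫⁻ φ, f ((rotation 3 τ).postcomp φ) ∂m = ∫⁻ φ, f φ ∂m := by
  rw [← hm (rotation 3 τ) f hf]
  simp only [circlePairing, schwarzian_rotation, zero_mul, integral_zero, mul_zero, Real.exp_zero,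
    ENNReal.ofReal_one, mul_one]

theorem lintegral_symm_div_speed (φ : CircleDiffeo 1) (g : C(UnitAddCircle, ℝ≥0)) :
    ∫⁻ u, (g (φ.symm u) : ℝ≥0∞) * ENNReal.ofReal (1 / φ.speed u) = ∫⁻ u, g u := by
  have hg : Continuous fun u => (g u : ℝ) := NNReal.continuous_coe.comp g.continuous
  have hcont : Continuous fun u => (g (φ.symm u) : ℝ) / φ.speed u :=
    (hg.comp φ.symm.toHomeomorph.continuous).div
      (NNReal.continuous_coe.comp φ.speed.continuous) fun u => (φ.speed_pos u).ne'
  have hquot := ofReal_integral_eq_lintegral_ofReal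
    (integrable_of_continuous (μ := volume) hcont) (Eventually.of_forall fun u =>
      div_nonneg (g _).coe_nonneg (φ.speed u).coe_nonneg)
  have hroot := ofReal_integral_eq_lintegral_ofReal (integrable_of_continuous (μ := volume) hg)
    (Eventually.of_forall fun u => (g u).coe_nonneg)
  rw [φ.integral_symm_div_speed hg, hroot] at hquot
  simp only [ENNReal.ofReal_coe_nnreal] at hquot
  rw [hquot]
  refine lintegral_congr fun u => ?_
  rw [← ENNReal.ofReal_coe_nnreal, ← ENNReal.ofReal_mul (g _).coe_nonneg, mul_one_div]

/-- Rotations move the point `0` at which root and speed are evaluated, so the integral equals its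
average over all points, and `∫ g(φ⁻¹(u)) / φ'(φ⁻¹(u)) du = ∫ g`. -/
theorem SchwarzianQuasiInvariant.lintegral_div_speed {s : ℝ} {m : Measure (CircleDiffeo 1)}
    [SFinite m] (hm : SchwarzianQuasiInvariant s m) (g : C(UnitAddCircle, ℝ≥0)) (c : ℝ) :
    ∫⁻ φ, (g (φ.symm 0) : ℝ≥0∞) * ENNReal.ofReal (1 / φ.speed 0) *
        ENNReal.ofReal (Real.exp (-s * (c * φ.energy))) ∂m
      = (∫⁻ u, g u) * laplaceFunctional s m 1 fun _ => c := by
  set f : UnitAddCircle → CircleDiffeo 1 → ℝ≥0∞ := fun u φ =>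
    (g (φ.symm u) : ℝ≥0∞) * ENNReal.ofReal (1 / φ.speed u) *
      ENNReal.ofReal (Real.exp (-s * (c * φ.energy))) with hf
  have hE : Measurable energy := continuous_energy.measurable
  have hfm : Measurable (Function.uncurry f) := by
    have hroot : Measurable fun p : UnitAddCircle × CircleDiffeo 1 => g (p.2.symm p.1) :=
      (g.continuous.comp (continuous_symm_eval.comp continuous_swap)).measurable
    have hspeed : Measurable fun p : UnitAddCircle × CircleDiffeo 1 => (p.2.speed p.1 : ℝ) :=
      (NNReal.continuous_coe.comp (continuous_speed_eval.comp continuous_swap)).measurable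
    exact (hroot.coe_nnreal_ennreal.mul (hspeed.const_div 1).ennreal_ofReal).mul (by fun_prop)
  have hrotate : ∀ u, ∫⁻ φ, f u φ ∂m = ∫⁻ φ, f 0 φ ∂m := fun u => by
    rw [← hm.lintegral_rotation (-u) (f := f 0) hfm.of_uncurry_left]
    simp only [hf, speed_postcomp_rotation, energy_postcomp_rotation, symm_postcomp_rotation_zero,
      zero_sub, neg_neg]
  calc ∫⁻ φ, f 0 φ ∂m = ∫⁻ u, ∫⁻ φ, f u φ ∂m := by
        simp only [hrotate, lintegral_const, UnitAddCircle.measure_univ, mul_one]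
    _ = ∫⁻ φ, (∫⁻ u, g u) * ENNReal.ofReal (Real.exp (-s * (c * φ.energy))) ∂m := by
        rw [lintegral_lintegral_swap hfm.aemeasurable]
        refine lintegral_congr fun φ => ?_
        rw [lintegral_mul_const' _ _ ENNReal.ofReal_ne_top, lintegral_symm_div_speed]
    _ = (∫⁻ u, g u) * laplaceFunctional s m 1 fun _ => c := by
        rw [lintegral_const_mul _ (by fun_prop), laplaceFunctional_const]
        simp only [boltzmannIntegral, ContinuousMap.one_apply, ENNReal.coe_one, one_mul]

/-! ### The renewal identity -/

section Renewal

variable {s : ℝ} {m : Measure (CircleDiffeo 1)} {b₀ : ℝ} (hs : 0 < s) (hb₀ : 0 < b₀)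
  (hm : SchwarzianQuasiInvariant s m) (hfin : laplaceFunctional s m 1 (fun _ => b₀ ^ 2) < ∞)
  (g : C(UnitAddCircle, ℝ≥0)) {b : ℝ} (hb : b₀ ≤ b)
include hs hb₀ hm hfin hb

theorem boltzmannIntegral_pointInteraction {a : ℝ} (hab : b < a) :
    boltzmannIntegral s m g (fun φ => b ^ 2 * φ.energy + pointStrength a b * φ.speed 0)
      = laplaceFunctional s m g
          fun _ => Real.log (Real.sinh a / Real.sinh (a - b)) ^ 2 := by
  have hb' : 0 < b := hb₀.trans_le hb
  have hriccati : ∀ n, laplaceFunctional s m g (circlePointPotential a b n)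
      = laplaceFunctional s m g fun _ => (∫ x in (0 : ℝ)..1, pointRiccati a b n x) ^ 2 := fun n =>
    hm.laplaceFunctional_riccati g (contDiff_pointRiccati hb' hab n) (periodic_pointRiccati a b n)
      rfl (hb'.trans_le (le_integral_pointRiccati hb' hab n))
      fun x => (deriv_pointRiccati_add_sq hb' hab n x).symm
  have hlog := tendsto_laplaceFunctional_const hs.le hfin g hb₀
    (Eventually.of_forall fun n => hb.trans (le_integral_pointRiccati hb' hab n))
    (tendsto_integral_pointRiccati hb' hab)
  simp only [← hriccati] at hlog
  have hcont := continuous_circlePointPotential hb' hab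
  refine tendsto_nhds_unique (tendsto_boltzmannIntegral hs.le hfin g
    (fun n => (continuous_circlePairing_speed (hcont n)).measurable)
    (Eventually.of_forall fun n => mul_energy_le_circlePairing (hcont n) fun u => ?_)
    (tendsto_circlePairing_circlePointPotential hb' hab)) hlog
  exact (pow_le_pow_left₀ hb₀.le hb 2).trans (le_circlePointPotential a b n u)

theorem laplaceFunctional_const_eq_boltzmannIntegral {β : ℝ} (hβ : b < β) :
    laplaceFunctional s m g (fun _ => β ^ 2)
      = boltzmannIntegral s m g fun φ => b ^ 2 * φ.energy +
          2 * b / Real.sinh b * (Real.cosh β - Real.cosh b) * φ.speed 0 := by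
  obtain ⟨a, hab, ha⟩ := exists_sinh_eq (hb₀.trans_le hb) hβ
  have hsab : 0 < Real.sinh (a - b) := Real.sinh_pos_iff.2 (sub_pos.2 hab)
  rw [← pointStrength_eq (hb₀.trans_le hb) hab ha,
    boltzmannIntegral_pointInteraction hs hb₀ hm hfin g hb hab, ha,
    mul_div_cancel_right₀ _ hsab.ne', Real.log_exp]

theorem lintegral_sinh_mul_laplaceFunctional [SFinite m] :
    ∫⁻ β in Set.Ioi b, ENNReal.ofReal (Real.sinh β) * laplaceFunctional s m g (fun _ => β ^ 2)
      = ENNReal.ofReal (Real.sinh b / (2 * s * b)) * ((∫⁻ u, g u) *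
        laplaceFunctional s m 1 fun _ => b ^ 2) := by
  have hb' : 0 < b := hb₀.trans_le hb
  have hroot : Measurable fun φ : CircleDiffeo 1 => g (φ.symm 0) :=
    (g.continuous.comp (continuous_symm_apply 0)).measurable
  have hE : Measurable energy := continuous_energy.measurable
  have hspeed : Measurable fun p : ℝ × CircleDiffeo 1 => (p.2.speed 0 : ℝ) :=
    (NNReal.continuous_coe.comp (continuous_speed_eval.comp
      (continuous_snd.prodMk continuous_const))).measurable
  set f : ℝ → CircleDiffeo 1 → ℝ≥0∞ := fun β φ => g (φ.symm 0) * (ENNReal.ofReal (Real.sinh β) *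
    ENNReal.ofReal (Real.exp (-s * (b ^ 2 * φ.energy +
      2 * b / Real.sinh b * (Real.cosh β - Real.cosh b) * φ.speed 0)))) with hf
  have hfm : Measurable (Function.uncurry f) :=
    (hroot.comp measurable_snd).coe_nnreal_ennreal.mul (by fun_prop)
  calc ∫⁻ β in Set.Ioi b, ENNReal.ofReal (Real.sinh β) * laplaceFunctional s m g (fun _ => β ^ 2)
      = ∫⁻ β in Set.Ioi b, ∫⁻ φ, f β φ ∂m := by
        refine setLIntegral_congr_fun measurableSet_Ioi fun β hβ => ?_
        simp only [hf, mul_left_comm _ (ENNReal.ofReal (Real.sinh β))]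
        rw [lintegral_const_mul' _ _ ENNReal.ofReal_ne_top,
          laplaceFunctional_const_eq_boltzmannIntegral hs hb₀ hm hfin g hb hβ, boltzmannIntegral]
    _ = ∫⁻ φ, ENNReal.ofReal (Real.sinh b / (2 * s * b)) * (g (φ.symm 0) *
          ENNReal.ofReal (1 / φ.speed 0) *
            ENNReal.ofReal (Real.exp (-s * (b ^ 2 * φ.energy)))) ∂m := by
        rw [lintegral_lintegral_swap hfm.aemeasurable]
        refine lintegral_congr fun φ => ?_
        rw [lintegral_const_mul' _ _ ENNReal.coe_ne_top,
          lintegral_sinh_mul_exp_pointInteraction hs hb' (φ.speed_pos 0)]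
        ring
    _ = _ := by
        rw [lintegral_const_mul' _ _ ENNReal.ofReal_ne_top, hm.lintegral_div_speed]

end Renewal

/-! ### The partition function -/

theorem hasDerivAt_integral_Ioi {f : ℝ → ℝ} {a b : ℝ} (hf : IntegrableOn f (Set.Ioi a))
    (hc : ContinuousOn f (Set.Ioi a)) (hb : a < b) :
    HasDerivAt (fun x => ∫ y in Set.Ioi x, f y) (-f b) b := by
  have hnhds : Set.Ioi a ∈ 𝓝 b := Ioi_mem_nhds hb
  have hprimitive : HasDerivAt (fun x => ∫ y in a..x, f y) (f b) b :=
    intervalIntegral.integral_hasDerivAt_right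
      ((intervalIntegrable_iff_integrableOn_Ioc_of_le hb.le).2
        (hf.mono_set Set.Ioc_subset_Ioi_self))
      (hc.stronglyMeasurableAtFilter isOpen_Ioi b hb) (hc.continuousAt hnhds)
  refine (hprimitive.const_sub (∫ y in Set.Ioi a, f y)).congr_of_eventuallyEq ?_
  filter_upwards [hnhds] with x hx
  rw [← intervalIntegral.integral_interval_add_Ioi hf
    (hf.mono_set (Set.Ioi_subset_Ioi (le_of_lt hx))), add_sub_cancel_left]

theorem eqOn_mul_of_integral_Ioi_eq {f h : ℝ → ℝ} {a c : ℝ} (hf : IntegrableOn f (Set.Ioi a))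
    (hfc : ContinuousOn f (Set.Ioi a)) (hh : IntegrableOn h (Set.Ioi a))
    (hhc : ContinuousOn h (Set.Ioi a))
    (heq : ∀ b, a < b → ∫ y in Set.Ioi b, f y = c * ∫ y in Set.Ioi b, h y) :
    Set.EqOn f (fun b => c * h b) (Set.Ioi a) := fun b hb => by
  have hderiv := ((hasDerivAt_integral_Ioi hh hhc hb).const_mul c).congr_of_eventuallyEq
    (Filter.eventuallyEq_of_mem (Ioi_mem_nhds hb) heq)
  have := (hasDerivAt_integral_Ioi hf hfc hb).unique hderiv
  linarith

theorem exists_integral_Ioi_eq_mul_exp {f p p' : ℝ → ℝ} {a : ℝ} (hf : IntegrableOn f (Set.Ioi a))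
    (hfc : ContinuousOn f (Set.Ioi a)) (hp : ∀ b, a < b → HasDerivAt p (p' b) b)
    (heq : ∀ b, a < b → f b = p' b * ∫ y in Set.Ioi b, f y) :
    ∃ A, ∀ b, a < b → ∫ y in Set.Ioi b, f y = A * Real.exp (-p b) := by
  have hderiv : ∀ b, a < b →
      HasDerivAt (fun x => (∫ y in Set.Ioi x, f y) * Real.exp (p x)) 0 b := fun b hb => by
    convert! (hasDerivAt_integral_Ioi hf hfc hb).mul (hp b hb).exp using 1
    rw [heq b hb]
    ring
  obtain ⟨A, hA⟩ := isOpen_Ioi.exists_is_const_of_deriv_eq_zero (s := Set.Ioi a) isPreconnected_Ioi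
    (fun b hb => (hderiv b hb).differentiableAt.differentiableWithinAt)
    fun b hb => (hderiv b hb).deriv
  refine ⟨A, fun b hb => ?_⟩
  rw [← hA b hb, mul_assoc, ← Real.exp_add, add_neg_cancel, Real.exp_zero, mul_one]

theorem lintegral_coe_lt_top (g : C(UnitAddCircle, ℝ≥0)) : ∫⁻ u, (g u : ℝ≥0∞) < ∞ := by
  obtain ⟨C, hC⟩ := exists_forall_apply_le g
  refine (lintegral_mono fun u => ENNReal.coe_le_coe.2 (hC u)).trans_lt ?_
  rw [lintegral_const, UnitAddCircle.measure_univ, mul_one]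
  exact ENNReal.coe_lt_top

/-- The density in `β` of the renewal identity `lintegral_sinh_mul_laplaceFunctional`, as a real
number. -/
def renewalDensity (s : ℝ) (m : Measure (CircleDiffeo 1)) (g : C(UnitAddCircle, ℝ≥0)) (β : ℝ) : ℝ :=
  Real.sinh β * (laplaceFunctional s m g fun _ => β ^ 2).toReal

theorem renewalDensity_nonneg (s : ℝ) (m : Measure (CircleDiffeo 1)) (g : C(UnitAddCircle, ℝ≥0))
    {β : ℝ} (hβ : 0 ≤ β) : 0 ≤ renewalDensity s m g β :=
  mul_nonneg (Real.sinh_nonneg_iff.2 hβ) ENNReal.toReal_nonneg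

section PartitionFunction

variable {s : ℝ} {m : Measure (CircleDiffeo 1)} {b₀ : ℝ} (hs : 0 < s) (hb₀ : 0 < b₀)
  (hfin : laplaceFunctional s m 1 (fun _ => b₀ ^ 2) < ∞) (g : C(UnitAddCircle, ℝ≥0))

include hs hb₀ hfin

theorem ofReal_renewalDensity {β : ℝ} (hβ : b₀ ≤ β) :
    ENNReal.ofReal (renewalDensity s m g β)
      = ENNReal.ofReal (Real.sinh β) * laplaceFunctional s m g fun _ => β ^ 2 := by
  rw [renewalDensity, ENNReal.ofReal_mul (Real.sinh_nonneg_iff.2 (hb₀.le.trans hβ)),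
    ENNReal.ofReal_toReal (laplaceFunctional_const_lt_top hs.le hfin g hb₀ hβ).ne]

theorem continuousOn_renewalDensity : ContinuousOn (renewalDensity s m g) (Set.Ioi b₀) :=
  Real.continuous_sinh.continuousOn.mul fun _ hb => ContinuousAt.continuousWithinAt <|
    (ENNReal.tendsto_toReal (laplaceFunctional_const_lt_top hs.le hfin g hb₀ (le_of_lt hb)).ne).comp
      (tendsto_laplaceFunctional_const hs.le hfin g hb₀
        (eventually_of_mem (Ioi_mem_nhds hb) fun _ hx => le_of_lt hx) tendsto_id)

variable [SFinite m] (hm : SchwarzianQuasiInvariant s m)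
include hm

theorem lintegral_renewalDensity {b : ℝ} (hb : b₀ ≤ b) :
    ∫⁻ β in Set.Ioi b, ENNReal.ofReal (renewalDensity s m g β)
      = ENNReal.ofReal (Real.sinh b / (2 * s * b)) * ((∫⁻ u, g u) *
        laplaceFunctional s m 1 fun _ => b ^ 2) := by
  rw [← lintegral_sinh_mul_laplaceFunctional hs hb₀ hm hfin g hb]
  exact setLIntegral_congr_fun measurableSet_Ioi fun β hβ =>
    ofReal_renewalDensity hs hb₀ hfin g (hb.trans (le_of_lt hβ))

theorem integrableOn_renewalDensity : IntegrableOn (renewalDensity s m g) (Set.Ioi b₀) := by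
  refine ⟨(continuousOn_renewalDensity hs hb₀ hfin g).aestronglyMeasurable measurableSet_Ioi, ?_⟩
  rw [hasFiniteIntegral_iff_ofReal ((ae_restrict_mem measurableSet_Ioi).mono fun _ hb =>
    renewalDensity_nonneg s m g (hb₀.le.trans (le_of_lt hb))),
    lintegral_renewalDensity hs hb₀ hfin g hm le_rfl]
  exact ENNReal.mul_lt_top ENNReal.ofReal_lt_top (ENNReal.mul_lt_top (lintegral_coe_lt_top g) hfin)

theorem integral_renewalDensity {b : ℝ} (hb : b₀ < b) :
    ∫ β in Set.Ioi b, renewalDensity s m g β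
      = (∫⁻ u, g u).toReal * (renewalDensity s m 1 b / (2 * s * b)) := by
  have hb' : 0 < b := hb₀.trans hb
  have := Real.sinh_pos_iff.2 hb'
  rw [integral_eq_lintegral_of_nonneg_ae ((ae_restrict_mem measurableSet_Ioi).mono fun β hβ =>
    renewalDensity_nonneg s m g (hb'.le.trans (le_of_lt hβ)))
    (((continuousOn_renewalDensity hs hb₀ hfin g).mono
      (Set.Ioi_subset_Ioi hb.le)).aestronglyMeasurable measurableSet_Ioi),
    lintegral_renewalDensity hs hb₀ hfin g hm hb.le, ENNReal.toReal_mul, ENNReal.toReal_mul,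
    ENNReal.toReal_ofReal (by positivity), renewalDensity]
  ring

theorem integral_renewalDensity_one {b : ℝ} (hb : b₀ < b) :
    ∫ β in Set.Ioi b, renewalDensity s m 1 β = renewalDensity s m 1 b / (2 * s * b) := by
  simpa using integral_renewalDensity hs hb₀ hfin 1 hm hb

theorem renewalDensity_eq {b : ℝ} (hb : b₀ < b) :
    renewalDensity s m g b = (∫⁻ u, g u).toReal * renewalDensity s m 1 b :=
  eqOn_mul_of_integral_Ioi_eq (integrableOn_renewalDensity hs hb₀ hfin g hm)
    (continuousOn_renewalDensity hs hb₀ hfin g) (integrableOn_renewalDensity hs hb₀ hfin 1 hm)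
    (continuousOn_renewalDensity hs hb₀ hfin 1) (fun x hx => by
      rw [integral_renewalDensity hs hb₀ hfin g hm hx,
        integral_renewalDensity_one hs hb₀ hfin hm hx]) hb

theorem exists_renewalDensity_one_eq :
    ∃ C : ℝ≥0, ∀ b, b₀ < b → renewalDensity s m 1 b = C * (b * Real.exp (-s * b ^ 2)) := by
  have hderiv : ∀ b, b₀ < b → HasDerivAt (fun x => s * x ^ 2) (2 * s * b) b := fun b _ => by
    convert! (hasDerivAt_pow 2 b).const_mul s using 1
    ring
  have heq : ∀ b, b₀ < b → renewalDensity s m 1 b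
      = 2 * s * b * ∫ β in Set.Ioi b, renewalDensity s m 1 β := fun b hb => by
    have := hb₀.trans hb
    rw [integral_renewalDensity_one hs hb₀ hfin hm hb]
    field_simp
  obtain ⟨A, hA⟩ := exists_integral_Ioi_eq_mul_exp (integrableOn_renewalDensity hs hb₀ hfin 1 hm)
    (continuousOn_renewalDensity hs hb₀ hfin 1) hderiv heq
  have hA0 : 0 ≤ A := by
    refine nonneg_of_mul_nonneg_left ?_ (Real.exp_pos (-(s * (b₀ + 1) ^ 2)))
    rw [← hA _ (lt_add_one b₀)]
    exact setIntegral_nonneg measurableSet_Ioi fun β hβ =>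
      renewalDensity_nonneg s m 1 ((add_pos hb₀ one_pos).trans hβ).le
  refine ⟨NNReal.mk (2 * s * A) (by positivity), fun b hb => ?_⟩
  rw [heq b hb, hA b hb, neg_mul, NNReal.coe_mk]
  ring

theorem exists_laplaceFunctional_const_eq :
    ∃ C : ℝ≥0, ∀ (g : C(UnitAddCircle, ℝ≥0)) (b : ℝ), b₀ < b →
      laplaceFunctional s m g (fun _ => b ^ 2)
        = C * (∫⁻ u, g u) * ENNReal.ofReal (b * Real.exp (-s * b ^ 2) / Real.sinh b) := by
  obtain ⟨C, hC⟩ := exists_renewalDensity_one_eq hs hb₀ hfin hm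
  refine ⟨C, fun g b hb => ?_⟩
  have hb' : 0 < b := hb₀.trans hb
  have hsinh : 0 < Real.sinh b := Real.sinh_pos_iff.2 hb'
  have hreal : (laplaceFunctional s m g fun _ => b ^ 2).toReal
      = C * (∫⁻ u, g u).toReal * (b * Real.exp (-s * b ^ 2) / Real.sinh b) := by
    have h := renewalDensity_eq hs hb₀ hfin g hm hb
    rw [hC b hb, renewalDensity] at h
    rw [mul_div_assoc', eq_div_iff hsinh.ne']
    linear_combination h
  rw [← ENNReal.ofReal_toReal (laplaceFunctional_const_lt_top hs.le hfin g hb₀ hb.le).ne, hreal,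
    ENNReal.ofReal_mul (by positivity), ENNReal.ofReal_mul C.coe_nonneg, ENNReal.ofReal_coe_nnreal,
    ENNReal.ofReal_toReal (lintegral_coe_lt_top g).ne]

end PartitionFunction

/-! ### Periodic solutions of the Riccati equation -/

/-- The solution operator of `f' + l f = h` on periodic functions. -/
def periodicResolvent (l : ℝ) (h : C(UnitAddCircle, ℝ)) : C(UnitAddCircle, ℝ) where
  toFun u := (Real.exp l - 1)⁻¹ * ∫ t in (0 : ℝ)..1, Real.exp (l * t) * h (u + (t : UnitAddCircle))
  continuous_toFun := by
    have hadd : Continuous fun p : UnitAddCircle × ℝ => p.1 + (p.2 : UnitAddCircle) :=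
      continuous_fst.add ((AddCircle.continuous_mk' 1).comp continuous_snd)
    refine continuous_const.mul
      (intervalIntegral.continuous_parametric_intervalIntegral_of_continuous' ?_ 0 1)
    exact (Real.continuous_exp.comp (continuous_const.mul continuous_snd)).mul
      (h.continuous.comp hadd)

theorem periodicResolvent_apply (l : ℝ) (h : C(UnitAddCircle, ℝ)) (u : UnitAddCircle) :
    periodicResolvent l h u = (Real.exp l - 1)⁻¹ *
      ∫ t in (0 : ℝ)..1, Real.exp (l * t) * h (u + (t : UnitAddCircle)) := rfl

theorem continuous_resolvent_integrand (l : ℝ) (h : C(UnitAddCircle, ℝ)) (u : UnitAddCircle) :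
    Continuous fun t : ℝ => Real.exp (l * t) * h (u + (t : UnitAddCircle)) :=
  (Real.continuous_exp.comp (continuous_const.mul continuous_id)).mul
    (h.continuous.comp (continuous_const.add (AddCircle.continuous_mk' 1)))

theorem periodicResolvent_const {l : ℝ} (hl : 0 < l) (c : ℝ) (u : UnitAddCircle) :
    periodicResolvent l (ContinuousMap.const _ c) u = c / l := by
  have hexp : ∫ t in (0 : ℝ)..1, Real.exp (l * t) = (Real.exp l - 1) / l := by
    rw [intervalIntegral.integral_comp_mul_left (fun t => Real.exp t) hl.ne', integral_exp,
      mul_zero, mul_one, Real.exp_zero, smul_eq_mul, inv_mul_eq_div]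
  have := (sub_pos.2 (Real.one_lt_exp_iff.2 hl)).ne'
  simp only [periodicResolvent_apply, ContinuousMap.const_apply]
  rw [intervalIntegral.integral_mul_const, hexp]
  field_simp

theorem periodicResolvent_mono {l : ℝ} (hl : 0 ≤ l) {h₁ h₂ : C(UnitAddCircle, ℝ)}
    (h : ∀ u, h₁ u ≤ h₂ u) (u : UnitAddCircle) :
    periodicResolvent l h₁ u ≤ periodicResolvent l h₂ u :=
  mul_le_mul_of_nonneg_left (intervalIntegral.integral_mono_on zero_le_one
    ((continuous_resolvent_integrand l h₁ u).intervalIntegrable _ _)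
    ((continuous_resolvent_integrand l h₂ u).intervalIntegrable _ _) fun _ _ =>
    mul_le_mul_of_nonneg_left (h _) (Real.exp_pos _).le)
    (inv_nonneg.2 (sub_nonneg.2 (Real.one_le_exp hl)))

theorem periodicResolvent_sub (l : ℝ) (h₁ h₂ : C(UnitAddCircle, ℝ)) (u : UnitAddCircle) :
    periodicResolvent l (h₁ - h₂) u = periodicResolvent l h₁ u - periodicResolvent l h₂ u := by
  simp only [periodicResolvent_apply]
  rw [← mul_sub, ← intervalIntegral.integral_sub
    ((continuous_resolvent_integrand l h₁ u).intervalIntegrable _ _)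
    ((continuous_resolvent_integrand l h₂ u).intervalIntegrable _ _)]
  simp only [ContinuousMap.sub_apply, mul_sub]

theorem abs_periodicResolvent_le {l : ℝ} (hl : 0 < l) {h : C(UnitAddCircle, ℝ)} {c : ℝ}
    (hc : ∀ u, |h u| ≤ c) (u : UnitAddCircle) : |periodicResolvent l h u| ≤ c / l := by
  rw [abs_le, ← neg_div, ← periodicResolvent_const hl, ← periodicResolvent_const hl]
  exact ⟨periodicResolvent_mono hl.le (fun v => (abs_le.1 (hc v)).1) u,
    periodicResolvent_mono hl.le (fun v => (abs_le.1 (hc v)).2) u⟩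

theorem periodicResolvent_coe (l : ℝ) (h : C(UnitAddCircle, ℝ)) (y : ℝ) :
    periodicResolvent l h (y : UnitAddCircle) = (Real.exp l - 1)⁻¹ * (Real.exp (-(l * y)) *
      ∫ t in y..(y + 1), Real.exp (l * t) * h (t : UnitAddCircle)) := by
  have hshift := intervalIntegral.integral_comp_add_left (a := 0) (b := 1)
    (fun t : ℝ => Real.exp (l * t) * h (t : UnitAddCircle)) y
  rw [add_zero] at hshift
  rw [periodicResolvent_apply, ← hshift,
    ← intervalIntegral.integral_const_mul (Real.exp (-(l * y)))]
  congr 1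
  refine intervalIntegral.integral_congr fun t _ => ?_
  rw [← mul_assoc, ← Real.exp_add, AddCircle.coe_add]
  ring_nf

theorem hasDerivAt_periodicResolvent {l : ℝ} (hl : 0 < l) (h : C(UnitAddCircle, ℝ)) (x : ℝ) :
    HasDerivAt (fun y : ℝ => periodicResolvent l h (y : UnitAddCircle))
      (h (x : UnitAddCircle) - l * periodicResolvent l h (x : UnitAddCircle)) x := by
  set e : ℝ → ℝ := fun y => Real.exp (l * y) * h (y : UnitAddCircle) with he
  have hec : Continuous e := (Real.continuous_exp.comp (continuous_const.mul continuous_id)).mul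
    (h.continuous.comp (AddCircle.continuous_mk' 1))
  have hwindow : HasDerivAt (fun y => ∫ t in y..(y + 1), e t) (e (x + 1) - e x) x := by
    have hprimitive := hasDerivAt_integral_of_continuous hec 0
    refine (((hprimitive (x + 1)).comp_add_const x 1).sub (hprimitive x)).congr_of_eventuallyEq
      (Eventually.of_forall fun y => (intervalIntegral.integral_interval_sub_left
        (hec.intervalIntegrable _ _) (hec.intervalIntegrable _ _)).symm)
  have hjump : e (x + 1) - e x = (Real.exp l - 1) * Real.exp (l * x) * h (x : UnitAddCircle) := by
    simp only [he, AddCircle.coe_add, AddCircle.coe_period, add_zero, mul_add, mul_one,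
      Real.exp_add]
    ring
  have hexp : Real.exp (-(l * x)) * Real.exp (l * x) = 1 := by
    rw [← Real.exp_add, neg_add_cancel, Real.exp_zero]
  have := (sub_pos.2 (Real.one_lt_exp_iff.2 hl)).ne'
  rw [funext (periodicResolvent_coe l h)]
  convert! (((((hasDerivAt_id x).const_mul l).neg).exp).mul hwindow).const_mul (Real.exp l - 1)⁻¹
    using 1
  rw [periodicResolvent_coe, hjump]
  simp only [id]
  field_simp
  linear_combination (-h (x : UnitAddCircle) * (Real.exp l - 1)) * hexp

/-- The map with fixed points the periodic solutions of `r' + r² = w`, written as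
`r' + 2 N r = w + 2 N r - r²`. The right side is increasing in `r` for `r ≤ N`, which makes the map
a contraction of the functions with values in `[b, N]` when `b² ≤ w ≤ N²`. -/
def riccatiMap (N : ℝ) (w r : C(UnitAddCircle, ℝ)) : C(UnitAddCircle, ℝ) :=
  periodicResolvent (2 * N) (w + ContinuousMap.const _ (2 * N) * r - r * r)

section RiccatiMap

variable {b N : ℝ} {w : C(UnitAddCircle, ℝ)} (hN : 0 < N)
include hN

theorem mapsTo_riccatiMap (hw : ∀ u, b ^ 2 ≤ w u) (hwN : ∀ u, w u ≤ N ^ 2) :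
    Set.MapsTo (riccatiMap N w) {r | ∀ u, r u ∈ Set.Icc b N} {r | ∀ u, r u ∈ Set.Icc b N} := by
  intro r hr u
  have hconst : ∀ c, c = periodicResolvent (2 * N) (ContinuousMap.const _ (2 * N * c)) u :=
    fun c => by rw [periodicResolvent_const (by positivity), mul_div_cancel_left₀ _ (by positivity)]
  constructor
  · rw [hconst b]
    refine periodicResolvent_mono (by positivity) (fun v => ?_) u
    simp only [ContinuousMap.sub_apply, ContinuousMap.add_apply, ContinuousMap.mul_apply,
      ContinuousMap.const_apply]
    nlinarith [(hr v).1, (hr v).2, hw v]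
  · nth_rewrite 2 [hconst N]
    refine periodicResolvent_mono (by positivity) (fun v => ?_) u
    simp only [ContinuousMap.sub_apply, ContinuousMap.add_apply, ContinuousMap.mul_apply,
      ContinuousMap.const_apply]
    nlinarith [hwN v, sq_nonneg (N - r v)]

theorem dist_riccatiMap_le {r₁ r₂ : C(UnitAddCircle, ℝ)} (h₁ : ∀ u, r₁ u ∈ Set.Icc b N)
    (h₂ : ∀ u, r₂ u ∈ Set.Icc b N) :
    dist (riccatiMap N w r₁) (riccatiMap N w r₂) ≤ (1 - b / N) * dist r₁ r₂ := by
  have hbN : b ≤ N := (h₁ 0).1.trans (h₁ 0).2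
  rw [ContinuousMap.dist_le (mul_nonneg (sub_nonneg.2 ((div_le_one hN).2 hbN)) dist_nonneg)]
  intro u
  rw [Real.dist_eq, riccatiMap, riccatiMap, ← periodicResolvent_sub,
    show (1 - b / N) * dist r₁ r₂ = (2 * N - 2 * b) * dist r₁ r₂ / (2 * N) by field_simp]
  refine abs_periodicResolvent_le (by positivity) (fun v => ?_) u
  simp only [ContinuousMap.sub_apply, ContinuousMap.add_apply, ContinuousMap.mul_apply,
    ContinuousMap.const_apply]
  rw [show w v + 2 * N * r₁ v - r₁ v * r₁ v - (w v + 2 * N * r₂ v - r₂ v * r₂ v)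
    = (2 * N - r₁ v - r₂ v) * (r₁ v - r₂ v) by ring, abs_mul]
  refine mul_le_mul ?_ (Real.dist_eq (r₁ v) (r₂ v) ▸ ContinuousMap.dist_apply_le_dist v)
    (abs_nonneg _) (by linarith)
  rw [abs_le]
  constructor <;> linarith [(h₁ v).1, (h₁ v).2, (h₂ v).1, (h₂ v).2]

theorem exists_riccatiMap_eq (hb : 0 < b) (hw : ∀ u, b ^ 2 ≤ w u) (hwN : ∀ u, w u ≤ N ^ 2) :
    ∃ r, (∀ u, b ≤ r u) ∧ riccatiMap N w r = r := by
  have hbN : b ≤ N := le_of_sq_le_sq ((hw 0).trans (hwN 0)) hN.le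
  have hmaps := mapsTo_riccatiMap hN hw hwN
  have hcontr : ContractingWith (1 - b / N).toNNReal (hmaps.restrict _ _ _) := by
    refine ⟨?_, LipschitzWith.of_dist_le_mul fun r₁ r₂ => ?_⟩
    · rw [Real.toNNReal_lt_one]
      linarith [div_pos hb hN]
    · rw [Real.coe_toNNReal _ (sub_nonneg.2 ((div_le_one hN).2 hbN))]
      exact dist_riccatiMap_le hN r₁.2 r₂.2
  have hclosed : IsClosed {r : C(UnitAddCircle, ℝ) | ∀ u, r u ∈ Set.Icc b N} := by
    simp only [Set.ofPred_forall]
    exact isClosed_iInter fun u => isClosed_Icc.preimage (continuous_eval_const u)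
  obtain ⟨r, hr, hfix, -⟩ := hcontr.exists_fixedPoint' hclosed.isComplete hmaps
    (x := ContinuousMap.const _ b) (fun _ => ⟨le_rfl, hbN⟩) (edist_ne_top _ _)
  exact ⟨r, fun u => (hr u).1, hfix⟩

theorem hasDerivAt_of_riccatiMap_eq {r : C(UnitAddCircle, ℝ)} (hr : riccatiMap N w r = r) (x : ℝ) :
    HasDerivAt (fun y : ℝ => r (y : UnitAddCircle))
      (w (x : UnitAddCircle) - r (x : UnitAddCircle) ^ 2) x := by
  have h := hasDerivAt_periodicResolvent (mul_pos two_pos hN)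
    (w + ContinuousMap.const _ (2 * N) * r - r * r) x
  rw [← riccatiMap, hr] at h
  convert! h using 1
  simp only [ContinuousMap.sub_apply, ContinuousMap.add_apply, ContinuousMap.mul_apply,
    ContinuousMap.const_apply]
  ring

end RiccatiMap

theorem exists_periodic_riccati_solution (w : C(UnitAddCircle, ℝ)) {b : ℝ} (hb : 0 < b)
    (hw : ∀ u, b ^ 2 ≤ w u) :
    ∃ r : ℝ → ℝ, ContDiff ℝ 1 r ∧ Function.Periodic r 1 ∧ (∀ x, b ≤ r x) ∧
      ∀ x : ℝ, w (x : UnitAddCircle) = deriv r x + r x ^ 2 := by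
  obtain ⟨M, hM⟩ := (isCompact_range w.continuous).bddAbove
  have hwM : ∀ u, w u ≤ M := fun u => hM ⟨u, rfl⟩
  have hM0 : 0 < M := (pow_pos hb 2).trans_le ((hw 0).trans (hwM 0))
  have hN : 0 < √M := Real.sqrt_pos.2 hM0
  obtain ⟨r, hbr, hfix⟩ := exists_riccatiMap_eq hN hb hw (by rwa [Real.sq_sqrt hM0.le])
  have hderiv := hasDerivAt_of_riccatiMap_eq hN hfix
  have hcont : Continuous fun x : ℝ => w (x : UnitAddCircle) - r (x : UnitAddCircle) ^ 2 :=
    (w.continuous.comp (AddCircle.continuous_mk' 1)).sub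
      ((r.continuous.comp (AddCircle.continuous_mk' 1)).pow 2)
  refine ⟨fun x => r (x : UnitAddCircle),
    contDiff_succ_of_hasDerivAt (n := 0) hderiv (contDiff_zero.2 hcont), fun x => ?_,
    fun x => hbr _, fun x => ?_⟩
  · beta_reduce
    rw [AddCircle.coe_add, AddCircle.coe_period, add_zero]
  · rw [(hderiv x).deriv, sub_add_cancel]

/-! ### Measures determined by their Laplace functional -/

instance : MeasurableSpace C(UnitAddCircle, ℝ≥0) := borel _

instance : BorelSpace C(UnitAddCircle, ℝ≥0) := ⟨rfl⟩

theorem circlePairing_nonneg {v : UnitAddCircle → ℝ} (hv : ∀ u, 0 ≤ v u)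
    (q : C(UnitAddCircle, ℝ≥0)) : 0 ≤ circlePairing v q :=
  integral_nonneg fun u => mul_nonneg (hv u) (q u).coe_nonneg

theorem circlePairing_add {v₁ v₂ : UnitAddCircle → ℝ} (h₁ : Continuous v₁) (h₂ : Continuous v₂)
    (q : C(UnitAddCircle, ℝ≥0)) :
    circlePairing (v₁ + v₂) q = circlePairing v₁ q + circlePairing v₂ q := by
  simp only [circlePairing]
  rw [← integral_add (integrable_of_continuous (by fun_prop))
    (integrable_of_continuous (by fun_prop))]
  simp only [Pi.add_apply, add_mul]

theorem exists_circlePairing_ne_of_lt {q₁ q₂ : C(UnitAddCircle, ℝ≥0)} {u₀ : UnitAddCircle}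
    (hu₀ : q₁ u₀ < q₂ u₀) :
    ∃ v : C(UnitAddCircle, ℝ), (∀ u, 0 ≤ v u) ∧ circlePairing v q₁ ≠ circlePairing v q₂ := by
  let v : C(UnitAddCircle, ℝ) := ⟨fun u => max ((q₂ u : ℝ) - q₁ u) 0, by fun_prop⟩
  refine ⟨v, fun u => le_max_right _ _, fun heq => ?_⟩
  have hpos : 0 < ∫ u, v u ^ 2 := by
    refine (v.continuous.pow 2).integral_pos_of_hasCompactSupport_nonneg_nonzero
      (HasCompactSupport.of_compactSpace _) (fun u => sq_nonneg (v u)) (x := u₀) ?_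
    have : 0 < v u₀ := lt_max_of_lt_left (sub_pos.2 (NNReal.coe_lt_coe.2 hu₀))
    exact pow_ne_zero 2 this.ne'
  have hsq : ∀ u, v u * q₂ u - v u * q₁ u = v u ^ 2 := fun u => by
    simp only [v, ContinuousMap.coe_mk]
    rcases le_total ((q₂ u : ℝ) - q₁ u) 0 with h | h
    · rw [max_eq_right h]
      ring
    · rw [max_eq_left h]
      ring
  have hdiff : circlePairing v q₂ - circlePairing v q₁ = ∫ u, v u ^ 2 := by
    simp only [circlePairing]
    rw [← integral_sub (integrable_of_continuous (by fun_prop))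
      (integrable_of_continuous (by fun_prop))]
    simp only [hsq]
  rw [heq, sub_self] at hdiff
  exact hpos.ne hdiff

theorem exists_circlePairing_ne {q₁ q₂ : C(UnitAddCircle, ℝ≥0)} (h : q₁ ≠ q₂) :
    ∃ v : C(UnitAddCircle, ℝ), (∀ u, 0 ≤ v u) ∧ circlePairing v q₁ ≠ circlePairing v q₂ := by
  obtain ⟨u₀, hu₀⟩ := DFunLike.ne_iff.1 h
  rcases lt_or_gt_of_ne hu₀ with hlt | hlt
  · exact exists_circlePairing_ne_of_lt hlt
  · obtain ⟨v, hv, hne⟩ := exists_circlePairing_ne_of_lt hlt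
    exact ⟨v, hv, hne.symm⟩

open scoped BoundedContinuousFunction in
theorem ext_of_forall_mem_submonoid_integral_eq {X : Type*} [PseudoEMetricSpace X]
    [CompleteSpace X] [SecondCountableTopology X] [MeasurableSpace X] [BorelSpace X]
    {P Q : Measure X} [IsFiniteMeasure P] [IsFiniteMeasure Q] {M : Submonoid (X →ᵇ ℝ)}
    (hsep : ∀ x y, x ≠ y → ∃ f ∈ M, f x ≠ f y) (hM : ∀ f ∈ M, ∫ x, f x ∂P = ∫ x, f x ∂Q) :
    P = Q := by
  let A : StarSubalgebra ℝ (X →ᵇ ℝ) :=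
    { Algebra.adjoin ℝ (M : Set (X →ᵇ ℝ)) with
      star_mem' := fun {f} hf => by rwa [show star f = f from by ext; simp] }
  refine ext_of_forall_mem_subalgebra_integral_eq_of_pseudoEMetric_complete_countable
    (𝕜 := ℝ) (A := A) (fun x y hxy => ?_) fun f hf => ?_
  · obtain ⟨f, hf, hne⟩ := hsep x y hxy
    exact ⟨f, ⟨f.toContinuousMap, ⟨f, Algebra.subset_adjoin hf, rfl⟩, rfl⟩, hne⟩
  · replace hf : f ∈ Submodule.span ℝ (M : Set (X →ᵇ ℝ)) := by
      rw [← Submonoid.closure_eq M, ← Algebra.adjoin_eq_span]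
      exact hf
    induction hf using Submodule.span_induction with
    | mem f hf => exact hM f hf
    | zero => simp
    | add f₁ f₂ _ _ h₁ h₂ =>
      simp only [BoundedContinuousFunction.coe_add, Pi.add_apply]
      rw [integral_add (f₁.integrable P) (f₂.integrable P),
        integral_add (f₁.integrable Q) (f₂.integrable Q), h₁, h₂]
    | smul c f _ h =>
      simp only [BoundedContinuousFunction.coe_smul, smul_eq_mul]
      rw [integral_const_mul, integral_const_mul, h]

theorem continuous_laplaceTest (s : ℝ) (g : C(UnitAddCircle, ℝ≥0)) (v : C(UnitAddCircle, ℝ)) :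
    Continuous fun x : UnitAddCircle × C(UnitAddCircle, ℝ≥0) =>
      (g x.1 : ℝ) * Real.exp (-s * circlePairing v x.2) := by
  have := (continuous_circlePairing v.continuous).comp
    (continuous_snd (X := UnitAddCircle) (Y := C(UnitAddCircle, ℝ≥0)))
  exact (NNReal.continuous_coe.comp (g.continuous.comp continuous_fst)).mul
    (continuous_const.mul this).rexp

open scoped BoundedContinuousFunction in
/-- The test functions `(x, q) ↦ g(x) exp(-s ∫ v q)`, with `v ≥ 0`, of the Laplace functional. They
form a monoid, so that their span is an algebra. -/
def laplaceTest (s : ℝ) : Submonoid ((UnitAddCircle × C(UnitAddCircle, ℝ≥0)) →ᵇ ℝ) where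
  carrier := {f | ∃ (g : C(UnitAddCircle, ℝ≥0)) (v : C(UnitAddCircle, ℝ)), (∀ u, 0 ≤ v u) ∧
    ∀ x, f x = g x.1 * Real.exp (-s * circlePairing v x.2)}
  one_mem' := ⟨1, 0, fun _ => le_rfl, fun x => by simp [circlePairing]⟩
  mul_mem' := by
    rintro f₁ f₂ ⟨g₁, v₁, hv₁, h₁⟩ ⟨g₂, v₂, hv₂, h₂⟩
    refine ⟨g₁ * g₂, v₁ + v₂, fun u => add_nonneg (hv₁ u) (hv₂ u), fun x => ?_⟩
    rw [BoundedContinuousFunction.mul_apply, h₁, h₂, ContinuousMap.coe_add,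
      circlePairing_add v₁.continuous v₂.continuous, mul_add, Real.exp_add,
      ContinuousMap.mul_apply, NNReal.coe_mul]
    ring

section

variable {s : ℝ}

theorem exists_mem_laplaceTest (hs : 0 ≤ s) (g : C(UnitAddCircle, ℝ≥0))
    {v : C(UnitAddCircle, ℝ)} (hv : ∀ u, 0 ≤ v u) :
    ∃ f ∈ laplaceTest s, ∀ x, f x = g x.1 * Real.exp (-s * circlePairing v x.2) := by
  obtain ⟨C, hC⟩ := exists_forall_apply_le g
  refine ⟨BoundedContinuousFunction.ofNormedAddCommGroup _ (continuous_laplaceTest s g v) C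
    fun x => ?_, ⟨g, v, hv, fun x => rfl⟩, fun x => rfl⟩
  have hexp : Real.exp (-s * circlePairing v x.2) ≤ 1 := by
    rw [Real.exp_le_one_iff, neg_mul, neg_nonpos]
    exact mul_nonneg hs (circlePairing_nonneg hv x.2)
  rw [Real.norm_of_nonneg (mul_nonneg (g _).coe_nonneg (Real.exp_pos _).le)]
  exact (mul_le_of_le_one_right (g _).coe_nonneg hexp).trans (NNReal.coe_le_coe.2 (hC _))

theorem exists_mem_laplaceTest_ne (hs : 0 < s) {x y : UnitAddCircle × C(UnitAddCircle, ℝ≥0)}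
    (hxy : x ≠ y) : ∃ f ∈ laplaceTest s, f x ≠ f y := by
  suffices ∃ (g : C(UnitAddCircle, ℝ≥0)) (v : C(UnitAddCircle, ℝ)), (∀ u, 0 ≤ v u) ∧
      (g x.1 : ℝ) * Real.exp (-s * circlePairing v x.2)
        ≠ g y.1 * Real.exp (-s * circlePairing v y.2) by
    obtain ⟨g, v, hv, hne⟩ := this
    obtain ⟨f, hf, hfx⟩ := exists_mem_laplaceTest hs.le g hv
    exact ⟨f, hf, by rwa [hfx, hfx]⟩
  by_cases hroot : x.1 = y.1
  · obtain ⟨v, hv, hne⟩ := exists_circlePairing_ne fun h => hxy (Prod.ext hroot h)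
    refine ⟨1, v, hv, ?_⟩
    simpa [hs.ne'] using hne
  · refine ⟨⟨fun u => nndist u x.1, by fun_prop⟩, 0, fun _ => le_rfl, ?_⟩
    simpa [circlePairing, eq_comm] using hroot

theorem ext_of_lintegral_exp_circlePairing (hs : 0 < s)
    {P Q : Measure (UnitAddCircle × C(UnitAddCircle, ℝ≥0))} [IsFiniteMeasure P] [IsFiniteMeasure Q]
    (h : ∀ (g : C(UnitAddCircle, ℝ≥0)) (v : C(UnitAddCircle, ℝ)), (∀ u, 0 ≤ v u) →
      ∫⁻ x, (g x.1 : ℝ≥0∞) * ENNReal.ofReal (Real.exp (-s * circlePairing v x.2)) ∂P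
        = ∫⁻ x, (g x.1 : ℝ≥0∞) * ENNReal.ofReal (Real.exp (-s * circlePairing v x.2)) ∂Q) :
    P = Q := by
  refine ext_of_forall_mem_submonoid_integral_eq
    (fun _ _ => exists_mem_laplaceTest_ne hs) (M := laplaceTest s) ?_
  rintro f ⟨g, v, hv, hf⟩
  have hf0 : ∀ x, 0 ≤ f x := fun x => hf x ▸ mul_nonneg (g _).coe_nonneg (Real.exp_pos _).le
  have hofReal : ∀ x, ENNReal.ofReal (f x)
      = (g x.1 : ℝ≥0∞) * ENNReal.ofReal (Real.exp (-s * circlePairing v x.2)) := fun x => by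
    rw [hf, ENNReal.ofReal_mul (g _).coe_nonneg, ENNReal.ofReal_coe_nnreal]
  rw [integral_eq_lintegral_of_nonneg_ae (Eventually.of_forall hf0)
    (f.integrable P).aestronglyMeasurable, integral_eq_lintegral_of_nonneg_ae
    (Eventually.of_forall hf0) (f.integrable Q).aestronglyMeasurable]
  simp only [hofReal]
  rw [h g v hv]

end

/-- The root `φ⁻¹(0)` and the speed of a diffeomorphism, which together determine it. -/
def rootSpeed (φ : CircleDiffeo 1) : UnitAddCircle × C(UnitAddCircle, ℝ≥0) :=
  (φ.symm 0, φ.speed)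

theorem continuous_rootSpeed : Continuous rootSpeed :=
  (continuous_symm_apply 0).prodMk continuous_speed

theorem rootSpeed_injective : Function.Injective rootSpeed := fun _ _ h =>
  eq_of_symm_zero_eq_of_speed_eq (congrArg Prod.fst h) (congrArg Prod.snd h)

theorem laplaceFunctional_eq_lintegral_map (s : ℝ) (m : Measure (CircleDiffeo 1))
    (g : C(UnitAddCircle, ℝ≥0)) (v : C(UnitAddCircle, ℝ)) :
    laplaceFunctional s m g v = ∫⁻ x, (g x.1 : ℝ≥0∞) *
      ENNReal.ofReal (Real.exp (-s * circlePairing v x.2)) ∂(m.map rootSpeed) := by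
  have hmeas : Measurable fun x : UnitAddCircle × C(UnitAddCircle, ℝ≥0) =>
      (g x.1 : ℝ≥0∞) * ENNReal.ofReal (Real.exp (-s * circlePairing v x.2)) := by
    simpa only [ENNReal.ofReal_mul (g _).coe_nonneg, ENNReal.ofReal_coe_nnreal] using
      (continuous_laplaceTest s g v).measurable.ennreal_ofReal
  rw [lintegral_map hmeas continuous_rootSpeed.measurable]
  rfl

theorem laplaceFunctional_one_zero (s : ℝ) (m : Measure (CircleDiffeo 1)) :
    laplaceFunctional s m 1 0 = m Set.univ := by
  simp [laplaceFunctional, boltzmannIntegral, circlePairing]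

theorem le_of_forall_isCompact_le {X : Type*} [TopologicalSpace X] [MeasurableSpace X]
    {μ ν : Measure X} [μ.InnerRegular] (h : ∀ K, IsCompact K → μ K ≤ ν K) : μ ≤ ν := by
  refine Measure.le_iff.2 fun A hA => ?_
  rw [hA.measure_eq_iSup_isCompact]
  exact iSup₂_le fun K hKA => iSup_le fun hK => (h K hK).trans (measure_mono hKA)

section MapWithDensity

variable {X Y : Type*} [TopologicalSpace X] [MeasurableSpace X] [OpensMeasurableSpace X]
  [TopologicalSpace Y] [T2Space Y] [MeasurableSpace Y] [BorelSpace Y] {Φ : X → Y} {ρ : Y → ℝ≥0∞}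

theorem measure_eq_setLIntegral_map_withDensity (hΦ : Continuous Φ) (hinj : Function.Injective Φ)
    (hρ : Measurable ρ) (hρ0 : ∀ y, ρ y ≠ 0) (hρtop : ∀ y, ρ y ≠ ∞) (m : Measure X) {K : Set X}
    (hK : IsCompact K) :
    m K = ∫⁻ y in Φ '' K, (ρ y)⁻¹ ∂((m.withDensity fun x => ρ (Φ x)).map Φ) := by
  have hpre : Φ ⁻¹' (Φ '' K) = K := Set.preimage_image_eq K hinj
  have himage : MeasurableSet (Φ '' K) := (hK.image hΦ).isClosed.measurableSet
  have hΦm := hΦ.measurable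
  have hKm : MeasurableSet K := hpre ▸ hΦm himage
  have hρΦ : Measurable fun x => ρ (Φ x) := hρ.comp hΦm
  have hinv : Measurable fun y => (ρ y)⁻¹ := hρ.inv
  rw [setLIntegral_map himage hinv hΦm, hpre,
    setLIntegral_withDensity_eq_setLIntegral_mul _ hρΦ (hinv.fun_comp hΦm) hKm]
  simp only [Pi.mul_apply, ENNReal.mul_inv_cancel (hρ0 _) (hρtop _), lintegral_one,
    Measure.restrict_apply_univ]

theorem eq_of_map_withDensity_eq (hΦ : Continuous Φ) (hinj : Function.Injective Φ)
    (hρ : Measurable ρ) (hρ0 : ∀ y, ρ y ≠ 0) (hρtop : ∀ y, ρ y ≠ ∞) {μ ν : Measure X}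
    [μ.InnerRegular] [ν.InnerRegular]
    (h : (μ.withDensity fun x => ρ (Φ x)).map Φ = (ν.withDensity fun x => ρ (Φ x)).map Φ) :
    μ = ν := by
  have hcompact : ∀ K, IsCompact K → μ K = ν K := fun K hK => by
    rw [measure_eq_setLIntegral_map_withDensity hΦ hinj hρ hρ0 hρtop μ hK, h,
      ← measure_eq_setLIntegral_map_withDensity hΦ hinj hρ hρ0 hρtop ν hK]
  exact le_antisymm (le_of_forall_isCompact_le fun K hK => (hcompact K hK).le)
    (le_of_forall_isCompact_le fun K hK => (hcompact K hK).ge)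

end MapWithDensity

theorem eq_of_laplaceFunctional_reweight_eq {s σ αsq βsq : ℝ} (hs : 0 < s)
    {μ ν : Measure (CircleDiffeo 1)} [μ.InnerRegular] [ν.InnerRegular]
    (hfin : reweight σ αsq βsq μ Set.univ < ∞)
    (h : ∀ (g : C(UnitAddCircle, ℝ≥0)) (v : C(UnitAddCircle, ℝ)), (∀ u, 0 ≤ v u) →
      laplaceFunctional s (reweight σ αsq βsq μ) g v
        = laplaceFunctional s (reweight σ αsq βsq ν) g v) : μ = ν := by
  let ρ : UnitAddCircle × C(UnitAddCircle, ℝ≥0) → ℝ≥0∞ := fun x =>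
    ENNReal.ofReal (Real.exp (2 * (βsq - αsq) / σ ^ 2 * circlePairing (fun _ => 1) x.2))
  have hρ : Measurable ρ := (((continuous_circlePairing continuous_const).comp
    continuous_snd).measurable.const_mul _).exp.ennreal_ofReal
  have hreweight : ∀ m : Measure (CircleDiffeo 1),
      reweight σ αsq βsq m = m.withDensity fun φ => ρ (rootSpeed φ) := fun m => by
    simp only [ρ, rootSpeed, circlePairing_const_speed, one_mul, reweight]
  have : IsFiniteMeasure (reweight σ αsq βsq μ) := ⟨hfin⟩
  have : IsFiniteMeasure (reweight σ αsq βsq ν) := ⟨by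
    rwa [← laplaceFunctional_one_zero s, ← ContinuousMap.coe_zero, ← h 1 0 fun _ => le_rfl,
      ContinuousMap.coe_zero, laplaceFunctional_one_zero]⟩
  refine eq_of_map_withDensity_eq continuous_rootSpeed rootSpeed_injective hρ
    (fun x => (ENNReal.ofReal_pos.2 (Real.exp_pos _)).ne') (fun x => ENNReal.ofReal_ne_top) ?_
  rw [← hreweight, ← hreweight]
  refine ext_of_lintegral_exp_circlePairing hs fun g v hv => ?_
  rw [← laplaceFunctional_eq_lintegral_map, ← laplaceFunctional_eq_lintegral_map, h g v hv]

/-! ### Orbital measures -/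

section

variable {σ αsq : ℝ} {μ : Measure (CircleDiffeo 1)}

theorem orbitalDensity_eq (σ αsq : ℝ) (ψ : CircleDiffeo 3) (φ : CircleDiffeo 1) :
    orbitalDensity σ αsq ψ φ = Real.exp (1 / σ ^ 2 * (circlePairing ψ.schwarzian φ.speed
      + 2 * αsq * ((ψ.postcomp φ).energy - φ.energy))) := by
  have hS := continuous_schwarzian ψ
  have hd := continuous_derivative_of_one_le (by norm_num) ψ
  have hq : Integrable fun u => (φ.speed u : ℝ) := integrable_of_continuous (by fun_prop)
  have hdq : Integrable fun u => ψ.derivative u ^ 2 * φ.speed u :=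
    integrable_of_continuous (by fun_prop)
  have hSq : Integrable fun u => ψ.schwarzian u * φ.speed u :=
    integrable_of_continuous (by fun_prop)
  have hdiff : Integrable fun u => 2 * αsq * (ψ.derivative u ^ 2 * φ.speed u - φ.speed u) :=
    (hdq.sub hq).const_mul _
  rw [orbitalDensity, ← φ.integral_mul_speed (w := fun u =>
    ψ.schwarzian u + 2 * αsq * (ψ.derivative u ^ 2 - 1)) (by fun_prop), energy_postcomp, energy_eq,
    circlePairing, ← integral_sub hdq hq, ← integral_const_mul (2 * αsq),
    ← integral_add hSq hdiff]
  congr 3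
  ext u
  ring

theorem continuous_orbitalDensity (σ αsq : ℝ) (ψ : CircleDiffeo 3) :
    Continuous (orbitalDensity σ αsq ψ) := by
  have hS := continuous_circlePairing_speed (continuous_schwarzian ψ)
  have hE := continuous_energy.comp (continuous_postcomp ψ)
  rw [funext (orbitalDensity_eq σ αsq ψ)]
  exact (continuous_const.mul
    (hS.add (continuous_const.mul (hE.sub continuous_energy)))).rexp

theorem IsOrbitalMeasure.lintegral_postcomp (hμ : IsOrbitalMeasure σ αsq μ) (ψ : CircleDiffeo 3)
    {f : CircleDiffeo 1 → ℝ≥0∞} (hf : Measurable f) :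
    ∫⁻ φ, ENNReal.ofReal (orbitalDensity σ αsq ψ φ) * f (ψ.postcomp φ) ∂μ = ∫⁻ φ, f φ ∂μ := by
  have hψ := (continuous_postcomp ψ).measurable
  have hmap : (μ.withDensity fun φ => ENNReal.ofReal (orbitalDensity σ αsq ψ φ)).map ψ.postcomp
      = μ := by
    refine Measure.ext fun B hB => ?_
    rw [Measure.map_apply hψ hB, withDensity_apply _ (hψ hB),
      ← hμ.change_of_variables ψ _ (hψ hB), Set.image_preimage_eq B ψ.postcomp_surjective]
  conv_rhs => rw [← hmap]
  rw [lintegral_map hf hψ, lintegral_withDensity_eq_lintegral_mul _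
    (continuous_orbitalDensity σ αsq ψ).measurable.ennreal_ofReal (hf.fun_comp hψ)]
  rfl

theorem measurable_exp_energy (c : ℝ) :
    Measurable fun φ : CircleDiffeo 1 => ENNReal.ofReal (Real.exp (c * φ.energy)) :=
  (continuous_energy.measurable.const_mul c).exp.ennreal_ofReal

theorem IsOrbitalMeasure.schwarzianQuasiInvariant (hμ : IsOrbitalMeasure σ αsq μ) :
    SchwarzianQuasiInvariant (2 / σ ^ 2) (reweight σ αsq 0 μ) := by
  intro ψ f hf
  have hρ := measurable_exp_energy (2 * (0 - αsq) / σ ^ 2)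
  have hS : Measurable fun φ : CircleDiffeo 1 =>
      ENNReal.ofReal (Real.exp (2 / σ ^ 2 / 2 * circlePairing ψ.schwarzian φ.speed)) :=
    ((continuous_circlePairing_speed
      (continuous_schwarzian ψ)).measurable.const_mul _).exp.ennreal_ofReal
  have hfS : Measurable fun φ => f (ψ.postcomp φ) *
      ENNReal.ofReal (Real.exp (2 / σ ^ 2 / 2 * circlePairing ψ.schwarzian φ.speed)) :=
    (hf.comp (continuous_postcomp ψ).measurable).mul hS
  rw [reweight, lintegral_withDensity_eq_lintegral_mul _ hρ hfS,
    lintegral_withDensity_eq_lintegral_mul _ hρ hf, ← hμ.lintegral_postcomp ψ (hρ.mul hf)]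
  refine lintegral_congr fun φ => ?_
  simp only [Pi.mul_apply]
  rw [orbitalDensity_eq, mul_comm (f _), ← mul_assoc, ← mul_assoc,
    ← ENNReal.ofReal_mul (Real.exp_pos _).le, ← ENNReal.ofReal_mul (Real.exp_pos _).le,
    ← Real.exp_add, ← Real.exp_add]
  ring_nf

theorem reweight_eq_withDensity (σ αsq β₁ β₂ : ℝ) (μ : Measure (CircleDiffeo 1)) :
    reweight σ αsq β₁ μ = (reweight σ αsq β₂ μ).withDensity
      fun φ => ENNReal.ofReal (Real.exp (2 * (β₁ - β₂) / σ ^ 2 * φ.energy)) := by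
  rw [reweight, reweight, ← withDensity_mul _ (measurable_exp_energy _) (measurable_exp_energy _)]
  congr 1
  ext φ
  rw [Pi.mul_apply, ← ENNReal.ofReal_mul (Real.exp_pos _).le, ← Real.exp_add]
  ring_nf

theorem laplaceFunctional_reweight (c : ℝ) (μ : Measure (CircleDiffeo 1))
    (g : C(UnitAddCircle, ℝ≥0)) {v : UnitAddCircle → ℝ} (hv : Continuous v) :
    laplaceFunctional (2 / σ ^ 2) (reweight σ αsq (-c) μ) g v
      = laplaceFunctional (2 / σ ^ 2) (reweight σ αsq 0 μ) g ((fun _ => c) + v) := by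
  rw [reweight_eq_withDensity σ αsq (-c) 0, laplaceFunctional, boltzmannIntegral,
    lintegral_withDensity_eq_lintegral_mul _ (measurable_exp_energy _)
      (measurable_boltzmannIntegral_integrand _ g
        (continuous_circlePairing_speed hv).measurable)]
  refine lintegral_congr fun φ => ?_
  rw [Pi.mul_apply, mul_left_comm, ← ENNReal.ofReal_mul (Real.exp_pos _).le, ← Real.exp_add]
  beta_reduce
  rw [circlePairing_add continuous_const hv, circlePairing_const_speed]
  ring_nf

theorem reweight_univ_mono (σ αsq : ℝ) {β₁ β₂ : ℝ} (h : β₁ ≤ β₂) (μ : Measure (CircleDiffeo 1)) :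
    reweight σ αsq β₁ μ Set.univ ≤ reweight σ αsq β₂ μ Set.univ := by
  simp only [reweight, withDensity_apply _ MeasurableSet.univ]
  refine lintegral_mono fun φ => ENNReal.ofReal_le_ofReal (Real.exp_le_exp.2 ?_)
  have := φ.energy_nonneg
  gcongr

theorem eq_zero_of_reweight_univ_eq_zero {βsq : ℝ} (h : reweight σ αsq βsq μ Set.univ = 0) :
    μ = 0 := by
  have hac : μ ≪ reweight σ αsq βsq μ :=
    withDensity_absolutelyContinuous' (measurable_exp_energy _).aemeasurable
      (Eventually.of_forall fun _ => (ENNReal.ofReal_pos.2 (Real.exp_pos _)).ne')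
  exact Measure.measure_univ_eq_zero.1 (hac h)

theorem IsRegularOrbitalMeasure.exists_forall_finite (hμ : IsRegularOrbitalMeasure σ αsq μ) :
    ∃ B : ℝ, 0 < B ∧ ∀ b, B ≤ b → reweight σ αsq (-b ^ 2) μ Set.univ < ∞ := by
  obtain ⟨βsq, hβ⟩ := hμ.exists_finite
  refine ⟨1 + |βsq|, by positivity, fun b hb => (reweight_univ_mono σ αsq ?_ μ).trans_lt hβ⟩
  nlinarith [abs_nonneg βsq, neg_abs_le βsq]

theorem exists_laplaceFunctional_eq_const (w : C(UnitAddCircle, ℝ)) {b : ℝ} (hb : 0 < b)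
    (hw : ∀ u, b ^ 2 ≤ w u) :
    ∃ β, b ≤ β ∧ ∀ (s : ℝ) (m : Measure (CircleDiffeo 1)), SchwarzianQuasiInvariant s m →
      ∀ g, laplaceFunctional s m g w = laplaceFunctional s m g fun _ => β ^ 2 := by
  obtain ⟨r, hr, hp, hbr, hrw⟩ := exists_periodic_riccati_solution w hb hw
  have hβ : b ≤ ∫ x in (0 : ℝ)..1, r x := by
    simpa using intervalIntegral.integral_mono_on (μ := volume) zero_le_one
      (intervalIntegrable_const (c := b)) (hr.continuous.intervalIntegrable _ _) fun x _ => hbr x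
  exact ⟨_, hβ, fun s m hm g => hm.laplaceFunctional_riccati g hr hp rfl (hb.trans_le hβ) hrw⟩

theorem exists_partitionFunction {s b₀ b : ℝ} (hs : 0 < s) (hb₀ : 0 < b₀) (hb : b₀ < b) :
    ∃ Z : C(UnitAddCircle, ℝ) → ℝ≥0∞, ∀ (m : Measure (CircleDiffeo 1)) [SFinite m],
      SchwarzianQuasiInvariant s m → laplaceFunctional s m 1 (fun _ => b₀ ^ 2) < ∞ →
      ∃ C : ℝ≥0, ∀ (g : C(UnitAddCircle, ℝ≥0)) (w : C(UnitAddCircle, ℝ)), (∀ u, b ^ 2 ≤ w u) →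
        laplaceFunctional s m g w = C * (∫⁻ u, g u) * Z w := by
  choose! β hbβ hβ using fun (w : C(UnitAddCircle, ℝ)) (hw : ∀ u, b ^ 2 ≤ w u) =>
    exists_laplaceFunctional_eq_const w (hb₀.trans hb) hw
  refine ⟨fun w => ENNReal.ofReal (β w * Real.exp (-s * β w ^ 2) / Real.sinh (β w)),
    fun m _ hm hfin => ?_⟩
  obtain ⟨C, hC⟩ := exists_laplaceFunctional_const_eq hs hb₀ hfin hm
  exact ⟨C, fun g w hw => by rw [hβ w hw s m hm g, hC g _ (hb.trans_le (hbβ w hw))]⟩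

theorem exists_partitionFunction_reweight (αsq : ℝ) {b₀ b : ℝ} (hσ : 0 < σ) (hb₀ : 0 < b₀)
    (hb : b₀ < b) :
    ∃ Z : C(UnitAddCircle, ℝ) → ℝ≥0∞, ∀ μ, IsOrbitalMeasure σ αsq μ →
      reweight σ αsq (-b₀ ^ 2) μ Set.univ < ∞ →
      ∃ C : ℝ≥0, ∀ (g : C(UnitAddCircle, ℝ≥0)) (v : C(UnitAddCircle, ℝ)), (∀ u, 0 ≤ v u) →
        laplaceFunctional (2 / σ ^ 2) (reweight σ αsq (-b ^ 2) μ) g v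
          = C * (∫⁻ u, g u) * Z v := by
  obtain ⟨Z, hZ⟩ := exists_partitionFunction (s := 2 / σ ^ 2) (by positivity) hb₀ hb
  refine ⟨fun v => Z (ContinuousMap.const _ (b ^ 2) + v), fun μ hμ hfin => ?_⟩
  have : IsFiniteMeasure (reweight σ αsq (-b₀ ^ 2) μ) := ⟨hfin⟩
  have : SFinite (reweight σ αsq 0 μ) := by
    rw [reweight_eq_withDensity σ αsq 0 (-b₀ ^ 2)]
    infer_instance
  have hfin₀ : laplaceFunctional (2 / σ ^ 2) (reweight σ αsq 0 μ) 1 (fun _ => b₀ ^ 2) < ∞ := by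
    rwa [← add_zero fun _ : UnitAddCircle => b₀ ^ 2,
      ← laplaceFunctional_reweight _ _ _ continuous_zero, laplaceFunctional_one_zero]
  obtain ⟨C, hC⟩ := hZ _ hμ.schwarzianQuasiInvariant hfin₀
  refine ⟨C, fun g v hv => ?_⟩
  rw [laplaceFunctional_reweight _ _ _ v.continuous]
  exact hC g (ContinuousMap.const _ (b ^ 2) + v) fun u => le_add_of_nonneg_right (hv u)

theorem laplaceFunctional_smul_measure (s : ℝ) (c : ℝ≥0) (m : Measure (CircleDiffeo 1))
    (g : C(UnitAddCircle, ℝ≥0)) (w : UnitAddCircle → ℝ) :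
    laplaceFunctional s (c • m) g w = c * laplaceFunctional s m g w := by
  simp only [laplaceFunctional, boltzmannIntegral, lintegral_smul_measure, ENNReal.smul_def,
    smul_eq_mul]

theorem reweight_smul (σ αsq βsq : ℝ) (c : ℝ≥0) (μ : Measure (CircleDiffeo 1)) :
    reweight σ αsq βsq (c • μ) = c • reweight σ αsq βsq μ :=
  withDensity_smul_measure (c : ℝ≥0∞) _

theorem IsRegularOrbitalMeasure.exists_eq_smul (hσ : 0 < σ) {ν : Measure (CircleDiffeo 1)}
    (hμ : IsRegularOrbitalMeasure σ αsq μ) (hν : IsRegularOrbitalMeasure σ αsq ν) (h0 : μ ≠ 0) :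
    ∃ c : ℝ≥0, ν = c • μ := by
  obtain ⟨B₁, hB₁, hfin₁⟩ := hμ.exists_forall_finite
  obtain ⟨B₂, _, hfin₂⟩ := hν.exists_forall_finite
  set b₀ := max B₁ B₂
  have hb : b₀ < b₀ + 1 := lt_add_one b₀
  obtain ⟨Z, hZ⟩ := exists_partitionFunction_reweight αsq hσ
    (hB₁.trans_le (le_max_left B₁ B₂)) hb
  obtain ⟨C₁, hC₁⟩ := hZ μ hμ.orbital (hfin₁ b₀ (le_max_left _ _))
  obtain ⟨C₂, hC₂⟩ := hZ ν hν.orbital (hfin₂ b₀ (le_max_right _ _))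
  have hC0 : C₁ ≠ 0 := by
    rintro rfl
    refine h0 (eq_zero_of_reweight_univ_eq_zero (σ := σ) (αsq := αsq) (βsq := -(b₀ + 1) ^ 2) ?_)
    rw [← laplaceFunctional_one_zero (2 / σ ^ 2), ← ContinuousMap.coe_zero,
      hC₁ 1 0 fun _ => le_rfl, ENNReal.coe_zero, zero_mul, zero_mul]
  refine ⟨C₂ / C₁, ?_⟩
  have := hμ.orbital.radon.innerRegular
  have := hν.orbital.radon.innerRegular
  refine eq_of_laplaceFunctional_reweight_eq (s := 2 / σ ^ 2) (by positivity)
    (hfin₂ (b₀ + 1) ((le_max_right _ _).trans hb.le)) fun g v hv => ?_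
  rw [reweight_smul, laplaceFunctional_smul_measure, hC₁ g v hv, hC₂ g v hv, ← mul_assoc,
    ← mul_assoc, ← ENNReal.coe_mul, div_mul_cancel₀ _ hC0]

theorem energy_translate (τ₀ : UnitAddCircle) (φ : CircleDiffeo 1) :
    (CircleDiffeo.translate τ₀ φ).energy = φ.energy := by
  rw [energy_eq, energy_eq, speed_translate]

theorem reweight_map_translate (σ αsq βsq : ℝ) (τ₀ : UnitAddCircle)
    (μ : Measure (CircleDiffeo 1)) :
    reweight σ αsq βsq (μ.map (CircleDiffeo.translate τ₀))
      = (reweight σ αsq βsq μ).map (CircleDiffeo.translate τ₀) := by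
  have hT := (continuous_translate τ₀).measurable
  refine Measure.ext fun A hA => ?_
  rw [Measure.map_apply hT hA, reweight, reweight, withDensity_apply _ hA,
    withDensity_apply _ (hT hA), setLIntegral_map hA (measurable_exp_energy _) hT]
  simp only [energy_translate]

theorem laplaceFunctional_map_translate (s : ℝ) (m : Measure (CircleDiffeo 1)) (τ₀ : UnitAddCircle)
    (g : C(UnitAddCircle, ℝ≥0)) {w : UnitAddCircle → ℝ} (hw : Continuous w) :
    laplaceFunctional s (m.map (CircleDiffeo.translate τ₀)) g w
      = laplaceFunctional s m (g.comp ⟨(· - τ₀), by fun_prop⟩) w := by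
  rw [laplaceFunctional, boltzmannIntegral, lintegral_map
    (measurable_boltzmannIntegral_integrand s g
      (continuous_circlePairing_speed hw).measurable)
    (continuous_translate τ₀).measurable]
  simp only [symm_translate, speed_translate, laplaceFunctional,
    boltzmannIntegral, ContinuousMap.comp_apply, ContinuousMap.coe_mk]

theorem IsRegularOrbitalMeasure.map_translate (hσ : 0 < σ) (hμ : IsRegularOrbitalMeasure σ αsq μ)
    (τ₀ : UnitAddCircle) : μ.map (CircleDiffeo.translate τ₀) = μ := by
  obtain ⟨b₀, hb₀, hfin⟩ := hμ.exists_forall_finite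
  have hb : b₀ < b₀ + 1 := lt_add_one b₀
  obtain ⟨Z, hZ⟩ := exists_partitionFunction_reweight αsq hσ hb₀ hb
  obtain ⟨C, hC⟩ := hZ μ hμ.orbital (hfin b₀ le_rfl)
  have := hμ.orbital.radon.innerRegular
  have : (μ.map (CircleDiffeo.translate τ₀)).InnerRegular :=
    Measure.InnerRegular.map_of_continuous (continuous_translate τ₀)
  refine (eq_of_laplaceFunctional_reweight_eq (s := 2 / σ ^ 2) (by positivity)
    (hfin (b₀ + 1) hb.le) fun g v hv => ?_).symm
  rw [reweight_map_translate, laplaceFunctional_map_translate _ _ _ _ v.continuous, hC g v hv,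
    hC _ v hv]
  congr 2
  exact (lintegral_sub_right_eq_self (fun u => (g u : ℝ≥0∞)) τ₀).symm

end

end

theorem mainTheorem2 (σ : ℝ) (hσ : 0 < σ) (αsq : ℝ) :
    (∀ μ ν : Measure (CircleDiffeo 1), IsRegularOrbitalMeasure σ αsq μ →
      IsRegularOrbitalMeasure σ αsq ν → μ ≠ 0 → ∃ c : ℝ≥0, ν = c • μ) ∧
    (∀ μ : Measure (CircleDiffeo 1), IsRegularOrbitalMeasure σ αsq μ →
      ∀ τ₀ : UnitAddCircle, MeasurePreserving (CircleDiffeo.translate τ₀) μ μ) :=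
  ⟨fun _ _ hμ hν hμ0 => hμ.exists_eq_smul hσ hν hμ0, fun _ hμ τ₀ =>
    ⟨(CircleDiffeo.continuous_translate τ₀).measurable, hμ.map_translate hσ τ₀⟩⟩
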